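/- **Conventions.** All topological abelian groups considered have a base of neighbourhoods of zero consisting of open subgroups. Such a group $A$ is *separated* if it is Hausdorff, and *complete* if the map $A\to\varprojlim_U A/U$ ($U$ ranging over the open subgroups) is surjective. A family $(a_x)_{x\in X}$ in $A$ *converges to zero* if every neighbourhood of zero contains $a_x$ for all but finitely many $x\in X$. A closed subgroup $H\subset A$ of a complete separated $A$ is *strongly closed* if $A/H$ (with the quotient topology) is complete and, for every set $X$, every $X$-indexed family in $A/H$ converging to zero lifts to an $X$-indexed family in $A$ converging to zero. **Categories.** Let $\mathsf A$ be an additive category with set-indexed coproducts. It is *agreeable* if for all objects $M$ and all families $(N_x)_{x\in X}$ of objects the map $\operatorname{Hom}(M,\coprod_x N_x)\to\prod_x\operatorname{Hom}(M,N_x)$ given by composition with the projections is injective; a family $(f_x\colon M\to N_x)_{x\in X}$ is *summable* if it lies in the image of this map. A *right topological* structure on $\mathsf A$ consists of a group topology on each $\operatorname{Hom}(M,N)$ such that the composition maps $\operatorname{Hom}(L,M)\times\operatorname{Hom}(M,N)\to\operatorname{Hom}(L,N)$ are continuous and the open $\operatorname{End}(N)$-submodules form a base of neighbourhoods of zero in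 $\operatorname{Hom}(M,N)$. A *topologically agreeable* category is an agreeable category with a right topological structure for which all the groups $\operatorname{Hom}(M,N)$ are complete and separated and every summable family of morphisms $f_x\colon M\to N$ converges to zero in $\operatorname{Hom}(M,N)$. A family of nonzero objects $(M_z)_{z\in Z}$ of an agreeable category is *locally T-nilpotent* if for every sequence $z_1,z_2,\dots\in Z$ and all nonisomorphisms $f_i\colon M_{z_i}\to M_{z_{i+1}}$ the family $(f_n\cdots f_1\colon M_{z_1}\to M_{z_{n+1}})_{n\ge1}$ is summable. An object $M$ has a *perfect decomposition* if $M\cong\coprod_{z\in Z}M_z$ for some locally T-nilpotent family $(M_z)_{z\in Z}$. **Rings.** Let $R$ be a complete, separated topological ring in which the open right ideals form a base of neighbourhoods of zero. Its *topological Jacobson radical* $H(R)$ is the intersection of all open maximal right ideals; it is a two-sided ideal. The ring $R$ is *topologically left perfect* if 1. $H(R)$ is topologically left T-nilpotent: for all $a_1,a_2,\dots\in H(R)$ the sequence $a_1,\ a_1a_2,\ a_1a_2a_3,\dots$ converges to zero; 2. $H(R)$ is strongly closed in $R$; 3. the ring $R/H(R)$ with the quotient topology is topologically semisimple, i.e.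 isomorphic as a topological ring to a product $\prod_{x\in X}\operatorname{End}_{D_x}(D_x^{(Y_x)})^{\mathrm{op}}$, with the product topology, where the $D_x$ are division rings, the $Y_x$ are nonempty sets, and each endomorphism ring carries the finite topology (a base of neighbourhoods of zero is formed by the annihilators of finite subsets of $D_x^{(Y_x)}$). **Theorem.** Let $\mathsf A$ be an idempotent-complete topologically agreeable additive category, let $M$ be an object of $\mathsf A$, and let $R=\operatorname{Hom}_{\mathsf A}(M,M)^{\mathrm{op}}$ be the opposite endomorphism ring of $M$, where $\operatorname{Hom}_{\mathsf A}(M,M)$ acts on $M$ on the left, with its complete, separated, right linear topology. Then $M$ has a perfect decomposition if and only if the topological ring $R$ is topologically left perfect. -/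

import Mathlib

open CategoryTheory CategoryTheory.Limits Filter Topology

-- Makes `M ⟶ N` elaborate through the category structure itself.
attribute [-instance] CategoryTheory.catToReflQuiver

universe v u w

noncomputable section

namespace TopPerfect

/-! ### Topological abelian groups -/

/-- A topological abelian group is complete when the map `A → lim_U A / U`, where `U` ranges over
the open subgroups of `A`, is surjective. An element of the limit is given here by representatives
`a U` of its components in `A / U`. -/
def IsCompleteGroup (A : Type w) [AddCommGroup A] [TopologicalSpace A] : Prop :=
  ∀ a : OpenAddSubgroup A → A, (∀ U V : OpenAddSubgroup A, U ≤ V → a U - a V ∈ V) →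
    ∃ x : A, ∀ U : OpenAddSubgroup A, x - a U ∈ U

/-- A family of elements of a topological abelian group converges to zero when every neighbourhood
of zero contains all but finitely many of its members. -/
def ZeroConvergent {A : Type w} [AddCommGroup A] [TopologicalSpace A] {X : Type*}
    (a : X → A) : Prop :=
  Tendsto a cofinite (𝓝 0)

/-- A closed subgroup `H` of `A` is strongly closed when `A / H` is complete and every
zero-convergent family in `A / H` lifts to a zero-convergent family in `A`. -/
structure IsStronglyClosed {A : Type w} [AddCommGroup A] [TopologicalSpace A]
    (H : AddSubgroup A) : Prop where
  isClosed : IsClosed (H : Set A)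
  complete_quotient : IsCompleteGroup (A ⧸ H)
  exists_lift : ∀ (X : Type w) (s : X → A ⧸ H), ZeroConvergent s →
    ∃ a : X → A, ZeroConvergent a ∧ ∀ x, (QuotientAddGroup.mk (a x) : A ⧸ H) = s x

/-! ### Topological rings. Right ideals of `R` are the `Rᵐᵒᵖ`-submodules of `R`. -/

section Rings

variable (R : Type w) [Ring R] [TopologicalSpace R]

/-- A subset `E` is topologically left T-nilpotent when `a₁`, `a₁a₂`, `a₁a₂a₃`, … converges to
zero for every sequence of elements `a₁, a₂, a₃, …` of `E`. -/
def IsTopLeftTNilpotent {R : Type w} [Ring R] [TopologicalSpace R] (E : Set R) : Prop :=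
  ∀ a : ℕ → R, (∀ i, a i ∈ E) →
    Tendsto (fun n : ℕ => ((List.range (n + 1)).map a).prod) atTop (𝓝 0)

variable [IsTopologicalRing R]

variable {R} in
/-- An intersection of all open maximal right ideals is stable under left multiplication. -/
theorem mul_mem_openMaximal (r : R) {h : R}
    (hh : ∀ I : Submodule Rᵐᵒᵖ R, IsOpen (I : Set R) → IsCoatom I → h ∈ I)
    (I : Submodule Rᵐᵒᵖ R) (hI : IsOpen (I : Set R)) (hm : IsCoatom I) : r * h ∈ I := by
  let J : Submodule Rᵐᵒᵖ R :=
    { carrier := {s | r * s ∈ I}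
      add_mem' := fun {a b} ha hb => by
        simpa only [Set.mem_ofPred_eq, mul_add] using I.add_mem ha hb
      zero_mem' := by simp
      smul_mem' := fun c x hx => by
        have := I.smul_mem c hx
        simpa only [Set.mem_ofPred_eq, MulOpposite.smul_eq_mul_unop, mul_assoc] using this }
  have hmemJ : ∀ s, s ∈ J ↔ r * s ∈ I := fun s => Iff.rfl
  have hJo : IsOpen (J : Set R) := hI.preimage (continuous_const_mul r)
  by_cases hr : r ∈ I
  · have := I.smul_mem (MulOpposite.op h) hr
    simpa only [MulOpposite.smul_eq_mul_unop, MulOpposite.unop_op] using this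
  · refine (hmemJ h).1 (hh J hJo ⟨fun hJ => hr ?_, fun K hK => ?_⟩)
    · have : (1 : R) ∈ J := hJ ▸ Submodule.mem_top
      simpa using (hmemJ 1).1 this
    · obtain ⟨hle, k, hkK, hkJ⟩ := SetLike.lt_iff_le_and_exists.1 hK
      have htop : I ⊔ Submodule.span Rᵐᵒᵖ {r * k} = ⊤ := by
        refine hm.2 _ (lt_of_le_of_ne le_sup_left fun he => hkJ ((hmemJ k).2 ?_))
        rw [he]
        exact Submodule.mem_sup_right (Submodule.mem_span_singleton_self _)
      have hrm : r ∈ I ⊔ Submodule.span Rᵐᵒᵖ {r * k} := htop ▸ Submodule.mem_top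
      obtain ⟨i, hi, y, hy, hiy⟩ := Submodule.mem_sup.1 hrm
      obtain ⟨t, rfl⟩ := Submodule.mem_span_singleton.1 hy
      have h1 : (1 : R) - k * t.unop ∈ J := by
        rw [hmemJ]
        have : r * (1 - k * t.unop) = i := by
          rw [MulOpposite.smul_eq_mul_unop] at hiy
          rw [mul_sub, mul_one, ← mul_assoc, sub_eq_iff_eq_add, hiy]
        rwa [this]
      have h2 : k * t.unop ∈ K := by
        simpa only [MulOpposite.smul_eq_mul_unop] using K.smul_mem t hkK
      have h3 : (1 : R) ∈ K := by simpa using K.add_mem (hle h1) h2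
      refine (Submodule.eq_top_iff').2 fun x => ?_
      simpa [MulOpposite.smul_eq_mul_unop] using K.smul_mem (MulOpposite.op x) h3

/-- The topological Jacobson radical: the intersection of all open maximal right ideals. It is
a two-sided ideal. -/
def topJacobson : Ideal R where
  carrier := {r | ∀ I : Submodule Rᵐᵒᵖ R, IsOpen (I : Set R) → IsCoatom I → r ∈ I}
  add_mem' := fun ha hb I hI hm => I.add_mem (ha I hI hm) (hb I hI hm)
  zero_mem' := fun I _ _ => I.zero_mem
  smul_mem' := fun c _ hx => mul_mem_openMaximal c hx

instance : (topJacobson R).IsTwoSided where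
  mul_mem_of_left := fun b ha I hI hm => by
    simpa only [MulOpposite.smul_eq_mul_unop, MulOpposite.unop_op] using
      I.smul_mem (MulOpposite.op b) (ha I hI hm)

end Rings

/-- The finite topology on `End_A(M)`: the topology of pointwise convergence, with `M` discrete.
A base of neighbourhoods of zero is given by the annihilators of the finite subsets (equivalently,
of the finitely generated submodules) of `M`. -/
abbrev finiteTopology (A : Type*) (M : Type*) [Ring A] [AddCommGroup M] [Module A M] :
    TopologicalSpace (Module.End A M) :=
  TopologicalSpace.induced (fun f : Module.End A M => (f : M → M))
    (@Pi.topologicalSpace M (fun _ => M) (fun _ => ⊥))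

section Semisimple

attribute [local instance] finiteTopology

/-- A topological ring is topologically semisimple when it is isomorphic, as a topological ring,
to a product `∏ₓ End_{Dₓ}(Dₓ^(Yₓ))ᵒᵖ` (with the product topology) of the opposite endomorphism
rings of nonzero vector spaces over division rings, with their finite topologies. -/
def IsTopSemisimple (S : Type w) [Ring S] [TopologicalSpace S] : Prop :=
  ∃ (X : Type w) (Y : X → Type w) (D : X → Type w) (_ : ∀ x, DivisionRing (D x)),
    (∀ x, Nonempty (Y x)) ∧
      ∃ e : S ≃+* ((x : X) → (Module.End (D x) (Y x →₀ D x))ᵐᵒᵖ), IsHomeomorph e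

end Semisimple

/-- Topological left perfectness of a (complete, separated, right linear) topological ring. -/
structure IsTopLeftPerfect (R : Type w) [Ring R] [TopologicalSpace R] [IsTopologicalRing R] :
    Prop where
  tNilpotent : IsTopLeftTNilpotent (topJacobson R : Set R)
  stronglyClosed : IsStronglyClosed (topJacobson R).toAddSubgroup
  semisimple : IsTopSemisimple (R ⧸ topJacobson R)

/-! ### Agreeable and topologically agreeable categories -/

section Categories

variable (C : Type u) [Category.{v} C] [Preadditive C]

variable {C} in
/-- The projection `∐ N ⟶ N x`: the identity on the summand `N x` and zero on the others. -/
def coprodProj {X : Type v} (N : X → C) [HasCoproduct N] (x : X) : ∐ N ⟶ N x :=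
  letI := Classical.decEq X
  Sigma.π N x

/-- An additive category with coproducts is agreeable when a morphism into a coproduct is
determined by its compositions with the projections onto the summands. -/
class Agreeable [HasCoproducts.{v} C] : Prop where
  eta_injective : ∀ (M : C) (X : Type v) (N : X → C),
    Function.Injective (fun (f : M ⟶ ∐ N) (x : X) => f ≫ coprodProj N x)

variable {C} in
/-- A family of morphisms `M ⟶ N x` is summable when it consists of the components of
a morphism from `M` to the coproduct of the `N x`. -/
def IsSummable [HasCoproducts.{v} C] {M : C} {X : Type v} {N : X → C}
    (f : (x : X) → (M ⟶ N x)) : Prop :=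
  ∃ F : M ⟶ ∐ N, ∀ x, F ≫ coprodProj N x = f x

/-- A right topological additive category: the groups of morphisms are topological groups,
composition is continuous in the pair of arguments, and the open `End(N)`-submodules form a base of
neighbourhoods of zero in `Hom(M, N)`. -/
class RightTopological where
  homTopology : ∀ M N : C, TopologicalSpace (M ⟶ N)
  isTopologicalAddGroup : ∀ M N : C, IsTopologicalAddGroup (M ⟶ N)
  continuous_comp : ∀ L M N : C,
    Continuous (fun p : (L ⟶ M) × (M ⟶ N) => p.1 ≫ p.2)
  exists_open_submodule : ∀ (M N : C), ∀ U ∈ 𝓝 (0 : M ⟶ N),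
    ∃ V : AddSubgroup (M ⟶ N), IsOpen (V : Set (M ⟶ N)) ∧
      (∀ f ∈ V, ∀ g : N ⟶ N, f ≫ g ∈ V) ∧ (V : Set (M ⟶ N)) ⊆ U

attribute [reducible] RightTopological.homTopology

attribute [instance] RightTopological.homTopology RightTopological.isTopologicalAddGroup

/-- A topologically agreeable category: an agreeable category with a complete, separated right
topological structure in which all summable families converge to zero. -/
class TopologicallyAgreeable [HasCoproducts.{v} C] [RightTopological C] : Prop
    extends Agreeable C where
  complete : ∀ M N : C, IsCompleteGroup (M ⟶ N)
  separated : ∀ M N : C, T2Space (M ⟶ N)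
  zeroConvergent_of_summable : ∀ (M N : C) (X : Type v) (f : X → (M ⟶ N)),
    IsSummable f → ZeroConvergent f

section

variable {C} [RightTopological C]

instance (M : C) : TopologicalSpace (End M) :=
  RightTopological.homTopology M M

instance (M : C) : IsTopologicalRing (End M) where
  continuous_add := (RightTopological.isTopologicalAddGroup M M).continuous_add
  continuous_neg := (RightTopological.isTopologicalAddGroup M M).continuous_neg
  continuous_mul := (RightTopological.continuous_comp M M M).comp continuous_swap

end

/-! ### Perfect decompositions -/

variable {C}

/-- The composition `N₀ ⟶ N₁ ⟶ ⋯ ⟶ N₍ₙ₊₁₎` of the first `n + 1` morphisms of a sequence. -/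
def compSeq {N : ℕ → C} (f : (i : ℕ) → (N i ⟶ N (i + 1))) : (n : ℕ) → (N 0 ⟶ N (n + 1))
  | 0 => f 0
  | n + 1 => compSeq f n ≫ f (n + 1)

/-- Local T-nilpotency of a family of nonzero objects. -/
structure IsLocallyTNilpotent [HasCoproducts.{v} C] {Z : Type v} (N : Z → C) : Prop where
  nonzero : ∀ z, ¬ IsZero (N z)
  summable : ∀ (z : ℕ → Z) (f : (i : ℕ) → (N (z i) ⟶ N (z (i + 1)))), (∀ i, ¬ IsIso (f i)) →
    IsSummable (fun n : ULift.{v} ℕ => compSeq (N := fun i => N (z i)) f n.down)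

/-- An object has a perfect decomposition when it is the coproduct of a locally T-nilpotent family
of objects. -/
def HasPerfectDecomposition [HasCoproducts.{v} C] (M : C) : Prop :=
  ∃ (Z : Type v) (N : Z → C), IsLocallyTNilpotent N ∧ Nonempty (M ≅ ∐ N)

end Categories

end TopPerfect

end

/-! Both conditions are compared with a third one on `R`: the existence of a perfect family, that
is, nonzero orthogonal idempotents `e z` with sum `1` such that noninvertible elements of the
corners `e z * R * e w` are T-nilpotent along every path of indices. Summands of `M` are split
idempotents of `R`, and between two fixed objects a family is summable exactly when it converges to
zero. Hence perfect decompositions of `M` are the same thing as perfect families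
(`hasPerfectDecomposition_iff_exists_isPerfectFamily`). If `R` is topologically left perfect with
radical `H`, the coordinate idempotents of `R/H` lift to a zero-convergent family because `H` is
strongly closed. `exists_orthogonal_lift` corrects it to orthogonal idempotents with sum `1`; the
obstruction is a matrix `k` over `H` with `k * k = -k`, which T-nilpotency kills. A corner element
outside `H` is invertible modulo `H`, hence invertible, so the noninvertible ones lie in `H`.
Conversely, in a perfect family every corner ring `e z * R * e z` is local, and the elements with
noninvertible `z`-th row form an open maximal right ideal `rowIdeal z`. The intersection of these
ideals is T-nilpotent, hence quasi-regular, and so equals `H`. Convergent sums of the form `∑ e z *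
r z`, with arbitrary `r z`, build the lifts for strong closedness. They also give density of `R` in
the endomorphism rings of the simple modules `R / rowIdeal z` over their Schur division rings, hence
semisimplicity of `R/H`. Both directions rest on a König argument (`exists_mem_pathSubgroup`): rows
converge to zero, so only finitely many branches stay outside an open right ideal, and convergence
along each path becomes a uniform bound. -/

noncomputable section

namespace TopPerfect

/-! ### Convergent sums in linearly topologized groups and rings -/

section Groups

variable {A : Type w} [AddCommGroup A] [TopologicalSpace A]

/-- A zero-convergent family in a complete nonarchimedean group is summable. -/
theorem exists_hasSum [NonarchimedeanAddGroup A] (hc : IsCompleteGroup A) {X : Type*} {a : X → A}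
    (ha : ZeroConvergent a) : ∃ s, HasSum a s := by
  classical
  have hfin : ∀ U : OpenAddSubgroup A, {x | a x ∉ U}.Finite := fun U =>
    ha (U.mem_nhds_zero)
  have key : ∀ (U : OpenAddSubgroup A) (s : Finset X), (hfin U).toFinset ⊆ s →
      ∑ x ∈ s, a x - ∑ x ∈ (hfin U).toFinset, a x ∈ U := by
    intro U s hs
    rw [← Finset.sum_sdiff hs, add_sub_cancel_right]
    refine sum_mem fun x hx => ?_
    simpa using (Finset.mem_sdiff.1 hx).2
  obtain ⟨s, hs⟩ := hc (fun U => ∑ x ∈ (hfin U).toFinset, a x) fun U V hUV =>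
    key V _ fun x hx => by
      have hx' : a x ∉ V := by simpa using hx
      simpa using fun h => hx' (hUV h)
  refine ⟨s, ?_⟩
  rw [HasSum, SummationFilter.unconditional_filter]
  intro W hW
  have hW0 : (fun x => s + x) ⁻¹' W ∈ 𝓝 (0 : A) :=
    (continuous_const_add s).continuousAt.preimage_mem_nhds (by simpa using hW)
  obtain ⟨U, hU⟩ := NonarchimedeanAddGroup.is_nonarchimedean _ hW0
  rw [mem_map, mem_atTop_sets]
  refine ⟨(hfin U).toFinset, fun t ht => ?_⟩
  have h1 : ∑ x ∈ t, a x - s ∈ U := by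
    have := U.sub_mem (key U t ht) (hs U)
    simpa using this
  have := hU h1
  simpa using this

theorem mem_addSubgroup_of_hasSum {X : Type*} {f : X → A} {s : A} (h : HasSum f s)
    {U : AddSubgroup A} (hU : IsClosed (U : Set A)) (hf : ∀ x, f x ∈ U) : s ∈ U := by
  rw [HasSum, SummationFilter.unconditional_filter] at h
  exact hU.mem_of_tendsto h (Eventually.of_forall fun t => sum_mem fun x _ => hf x)

theorem zeroConvergent_of_hasSum [IsTopologicalAddGroup A] {X : Type*} {f : X → A} {s : A}
    (h : HasSum f s) : ZeroConvergent f :=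
  h.summable.tendsto_cofinite_zero

end Groups

section Rings

variable {R : Type w} [Ring R]

theorem mul_mem_rightIdeal (U : Submodule Rᵐᵒᵖ R) {a : R} (ha : a ∈ U) (b : R) : a * b ∈ U := by
  simpa only [MulOpposite.smul_eq_mul_unop, MulOpposite.unop_op] using
    U.smul_mem (MulOpposite.op b) ha

/-! ### Products along paths of indices. -/

section PathSubgroup

variable {Z : Type*}

/-- The elements `q` such that `q * k n z z₁ * k (n + 1) z₁ z₂ * ⋯` lies in `U` for all paths
`z, z₁, …` of length `m`. -/
def pathSubgroup (U : AddSubgroup R) (k : ℕ → Z → Z → R) : ℕ → ℕ → Z → AddSubgroup R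
  | 0, _, _ => U
  | m + 1, n, z => ⨅ w, (pathSubgroup U k m (n + 1) w).comap (AddMonoidHom.mulRight (k n z w))

theorem mem_pathSubgroup_succ {U : AddSubgroup R} {k : ℕ → Z → Z → R} {m n : ℕ} {z : Z} {q : R} :
    q ∈ pathSubgroup U k (m + 1) n z ↔ ∀ w, q * k n z w ∈ pathSubgroup U k m (n + 1) w := by
  simp [pathSubgroup, AddSubgroup.mem_iInf]

/-- A right ideal absorbs right factors, so a product that has entered `U` stays there when the path
is prolonged. -/
theorem pathSubgroup_mono (U : Submodule Rᵐᵒᵖ R) (k : ℕ → Z → Z → R) {m m' : ℕ}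
    (h : m ≤ m') (n : ℕ) (z : Z) :
    pathSubgroup U.toAddSubgroup k m n z ≤ pathSubgroup U.toAddSubgroup k m' n z := by
  refine monotone_nat_of_le_succ (f := fun m => pathSubgroup U.toAddSubgroup k m n z)
    (fun m => ?_) h
  induction m generalizing n z with
  | zero => exact fun q hq => mem_pathSubgroup_succ.2 fun w => mul_mem_rightIdeal U hq _
  | succ m ih =>
    exact fun q hq => mem_pathSubgroup_succ.2 fun w => ih _ _ (mem_pathSubgroup_succ.1 hq w)

end PathSubgroup

variable [TopologicalSpace R]

theorem ZeroConvergent.finite_notMem {X : Type*} {f : X → R} (hf : ZeroConvergent f)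
    {U : Submodule Rᵐᵒᵖ R} (hU : IsOpen (U : Set R)) : {x | f x ∉ U}.Finite :=
  hf (hU.mem_nhds U.zero_mem)

/-- Powers of an element of a T-nilpotent set converge to zero. -/
theorem IsTopLeftTNilpotent.tendsto_pow {E : Set R} (hE : IsTopLeftTNilpotent E) {h : R}
    (hh : h ∈ E) : Tendsto (fun n : ℕ => h ^ n) atTop (𝓝 0) := by
  rw [← tendsto_add_atTop_iff_nat 1]
  simpa using hE (fun _ => h) fun _ => hh

variable [IsTopologicalRing R]

theorem isClosed_of_isOpen_rightIdeal {U : Submodule Rᵐᵒᵖ R} (hU : IsOpen (U : Set R)) :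
    IsClosed (U.toAddSubgroup : Set R) :=
  AddSubgroup.isClosed_of_isOpen U.toAddSubgroup hU

theorem ZeroConvergent.const_mul {X : Type*} {f : X → R} (hf : ZeroConvergent f) (q : R) :
    ZeroConvergent fun x => q * f x := by
  simpa [ZeroConvergent] using Tendsto.const_mul q hf

/-! ### Right linear topologies: geometric series and lifting of idempotents. -/

section Linear

variable [IsLinearTopology Rᵐᵒᵖ R]

theorem exists_open_rightIdeal {W : Set R} (hW : W ∈ 𝓝 (0 : R)) :
    ∃ U : Submodule Rᵐᵒᵖ R, IsOpen (U : Set R) ∧ (U : Set R) ⊆ W :=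
  let ⟨U, hU, hUW⟩ := (IsLinearTopology.hasBasis_open_submodule Rᵐᵒᵖ).mem_iff.1 hW
  ⟨U, hU, hUW⟩

theorem nonarchimedeanAddGroup_of_linear : NonarchimedeanAddGroup R where
  is_nonarchimedean _ hW :=
    let ⟨U, hU, hUW⟩ := exists_open_rightIdeal hW
    ⟨⟨U.toAddSubgroup, hU⟩, hUW⟩

theorem eq_zero_of_forall_mem [T2Space R] {a : R}
    (h : ∀ U : Submodule Rᵐᵒᵖ R, IsOpen (U : Set R) → a ∈ U) : a = 0 := by
  by_contra ha
  obtain ⟨U, hU, hUW⟩ := exists_open_rightIdeal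
    (isOpen_ne.mem_nhds (Ne.symm ha) : {b | b ≠ a} ∈ 𝓝 0)
  exact hUW (h U hU) rfl

/-- Open right ideals absorb the right factors, so nothing is required of `g`. Sums `∑ e z * r z`
with arbitrary `r z` therefore converge. -/
theorem ZeroConvergent.mul {X : Type*} {f : X → R} (hf : ZeroConvergent f) (g : X → R) :
    ZeroConvergent fun x => f x * g x := by
  intro W hW
  obtain ⟨U, hU, hUW⟩ := exists_open_rightIdeal hW
  refine mem_map.2 (mem_of_superset (mem_map.1 (hf (hU.mem_nhds U.zero_mem))) fun x hx => ?_)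
  exact hUW (mul_mem_rightIdeal U hx _)

theorem exists_hasSum_ring (hc : IsCompleteGroup R) {X : Type*} {a : X → R}
    (ha : ZeroConvergent a) : ∃ s, HasSum a s :=
  haveI := nonarchimedeanAddGroup_of_linear (R := R)
  exists_hasSum hc ha

/-- The inverse is the geometric series. -/
theorem exists_inv_one_sub [T2Space R] (hc : IsCompleteGroup R) {h : R}
    (hh : Tendsto (fun n : ℕ => h ^ n) atTop (𝓝 0)) :
    ∃ b, (1 - h) * b = 1 ∧ b * (1 - h) = 1 := by
  obtain ⟨b, hb⟩ := exists_hasSum_ring hc (a := fun n : ℕ => h ^ n)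
    (by rwa [ZeroConvergent, Nat.cofinite_eq_atTop])
  have h1 : HasSum (fun n : ℕ => h ^ (n + 1)) (b - 1) := by
    simpa using (hasSum_nat_add_iff' 1).2 hb
  have h2 : h * b = b - 1 := by
    refine HasSum.unique ?_ h1
    simpa [pow_succ'] using hb.mul_left h
  have h3 : b * h = b - 1 := by
    refine HasSum.unique ?_ h1
    simpa [pow_succ] using hb.mul_right h
  exact ⟨b, by rw [sub_mul, h2]; simp, by rw [mul_sub, h3]; simp⟩

/-- Idempotents lift modulo a closed ideal consisting of topologically nilpotent elements. -/
theorem exists_idempotent_lift [T2Space R] (hc : IsCompleteGroup R) (H : Ideal R) [H.IsTwoSided]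
    (hcl : IsClosed (H : Set R)) (hn : ∀ h ∈ H, Tendsto (fun n : ℕ => h ^ n) atTop (𝓝 0)) (a : R)
    (ha : a * a - a ∈ H) : ∃ e, e * e = e ∧ e - a ∈ H := by
  -- Newton iteration for `y ^ 2 = y`: the error `ν` is squared at each step, up to the factor `4 *
  -- ν - 3`.
  let x : ℕ → R := fun n => Nat.rec a (fun _ y => 3 * y ^ 2 - 2 * y ^ 3) n
  have hx : ∀ n, x (n + 1) = 3 * x n ^ 2 - 2 * x n ^ 3 := fun n => rfl
  let ν : ℕ → R := fun n => x n ^ 2 - x n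
  have hstep : ∀ n, x (n + 1) = x n + ν n * (1 - 2 * x n) := fun n => by
    simp only [hx, ν]; noncomm_ring
  have hν : ∀ n, ν (n + 1) = ν n * ν n * (4 * ν n - 3) := fun n => by
    simp only [hx, ν]; noncomm_ring
  have hcomm : ∀ n, Commute (ν 0) (ν n) := by
    have : ∀ n, Commute a (x n) := fun n => by
      induction n with
      | zero => exact Commute.refl a
      | succ n ih =>
        rw [hx]
        exact ((Commute.ofNat_right a 3).mul_right (ih.pow_right 2)).sub_right
          ((Commute.ofNat_right a 2).mul_right (ih.pow_right 3))
    intro n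
    exact (((this n).pow_right 2).sub_right (this n)).pow_left 2 |>.sub_left
      (((this n).pow_right 2).sub_right (this n))
  -- The power is moved to the left, where an open right ideal containing it absorbs the cofactor;
  -- this is why commutation with `ν 0` is tracked.
  have hdvd : ∀ n, ∃ t, ν n = ν 0 ^ (2 ^ n) * t ∧ Commute (ν 0) t := by
    intro n
    induction n with
    | zero => exact ⟨1, by simp, Commute.one_right _⟩
    | succ n ih =>
      obtain ⟨t, ht, hct⟩ := ih
      refine ⟨t * t * (4 * ν n - 3), ?_, ?_⟩
      · rw [hν]
        have : ν n * ν n = ν 0 ^ 2 ^ (n + 1) * (t * t) := by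
          rw [ht, pow_succ 2 n, pow_mul, sq (ν 0 ^ 2 ^ n)]
          have hc' := (hct.pow_left (2 ^ n)).eq
          rw [mul_assoc, ← mul_assoc t, ← hc']
          simp only [mul_assoc]
        rw [this, mul_assoc]
      · exact (hct.mul_right hct).mul_right
          (((Commute.ofNat_right _ 4).mul_right (hcomm n)).sub_right (Commute.ofNat_right _ 3))
  have hν0 : ν 0 ∈ H := by
    change a ^ 2 - a ∈ H
    rwa [sq]
  have hνH : ∀ n, ν n ∈ H := fun n => by
    obtain ⟨t, ht, -⟩ := hdvd n
    rw [ht]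
    exact H.mul_mem_right _ (H.pow_mem_of_mem hν0 _ (by positivity))
  have hνt : Tendsto ν atTop (𝓝 0) := by
    intro W hW
    obtain ⟨U, hU, hUW⟩ := exists_open_rightIdeal hW
    have h1 := (hn _ hν0).comp (tendsto_pow_atTop_atTop_of_one_lt one_lt_two)
    refine mem_map.2 (mem_of_superset (mem_map.1 (h1 (hU.mem_nhds U.zero_mem))) fun n hn' => ?_)
    obtain ⟨t, ht, -⟩ := hdvd n
    apply hUW
    rw [ht]
    exact mul_mem_rightIdeal U hn' t
  have hz : ZeroConvergent fun n => ν n * (1 - 2 * x n) :=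
    ZeroConvergent.mul (by rwa [ZeroConvergent, Nat.cofinite_eq_atTop]) _
  obtain ⟨s, hs⟩ := exists_hasSum_ring hc hz
  have hlim : Tendsto x atTop (𝓝 (a + s)) := by
    have hsum : ∀ n, x n = a + ∑ i ∈ Finset.range n, ν i * (1 - 2 * x i) := fun n => by
      induction n with
      | zero => simp [x]
      | succ n ih => rw [Finset.sum_range_succ, ← add_assoc, ← ih, hstep]
    refine Tendsto.congr (fun n => (hsum n).symm) ?_
    exact (hs.tendsto_sum_nat).const_add a
  refine ⟨a + s, ?_, ?_⟩
  · have h2 : Tendsto ν atTop (𝓝 ((a + s) ^ 2 - (a + s))) := (hlim.pow 2).sub hlim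
    have := tendsto_nhds_unique h2 hνt
    rw [← sq]
    exact sub_eq_zero.1 this
  · rw [add_sub_cancel_left]
    exact mem_addSubgroup_of_hasSum hs (U := H.toAddSubgroup) hcl fun n => H.mul_mem_right _ (hνH n)

end Linear

/-! ### A König-type lemma for row-convergent matrices -/

section Paths

variable {Z : Type*}

theorem isClosed_pathSubgroup {U : AddSubgroup R} (hU : IsClosed (U : Set R))
    (k : ℕ → Z → Z → R) (m n : ℕ) (z : Z) : IsClosed (pathSubgroup U k m n z : Set R) := by
  induction m generalizing n z with
  | zero => exact hU
  | succ m ih =>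
    have : (pathSubgroup U k (m + 1) n z : Set R) =
        ⋂ w, (fun q => q * k n z w) ⁻¹' (pathSubgroup U k m (n + 1) w : Set R) := by
      ext q
      simp [mem_pathSubgroup_succ]
    rw [this]
    exact isClosed_iInter fun w => (ih (n + 1) w).preimage (continuous_mul_const _)

variable (U : Submodule Rᵐᵒᵖ R) (k : ℕ → Z → Z → R)

/-- König's lemma. If no length works at a vertex, some successor is equally bad: successors with
product in `U` need length `0`, and only finitely many others remain, so bounds for all of them
would have a maximum. Iterating gives a path whose products never enter `U`. -/
theorem exists_mem_pathSubgroup (hU : IsOpen (U : Set R)) (hk : ∀ n z, ZeroConvergent (k n z))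
    (z : Z) (q : R)
    (hT : ∀ s : ℕ → Z, ∃ n, q * ((List.range n).map fun i => k i (s i) (s (i + 1))).prod ∈ U) :
    ∃ m, q ∈ pathSubgroup U.toAddSubgroup k m 0 z := by
  by_contra! hbad
  -- The implication stands inside the existential so that `choose` yields a successor defined at
  -- every vertex.
  have step : ∀ n z q, ∃ w, (∀ m, q ∉ pathSubgroup U.toAddSubgroup k m n z) →
      ∀ m, q * k n z w ∉ pathSubgroup U.toAddSubgroup k m (n + 1) w := by
    intro n z q
    by_contra! hcon
    have hq : ∀ m, q ∉ pathSubgroup U.toAddSubgroup k m n z := (hcon z).1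
    choose m hm using fun w => (hcon w).2
    have hfin := (ZeroConvergent.const_mul (hk n z) q).finite_notMem hU
    obtain ⟨B, hB⟩ := (hfin.image m).bddAbove
    refine hq (B + 1) (mem_pathSubgroup_succ.2 fun w => ?_)
    by_cases hw : q * k n z w ∈ U
    · exact pathSubgroup_mono U k (Nat.zero_le B) _ _ hw
    · exact pathSubgroup_mono U k (hB ⟨w, hw, rfl⟩) _ _ (hm w)
  choose w hw using step
  let S : ℕ → Z × R := fun n =>
    Nat.rec (z, q) (fun n p => (w n p.1 p.2, p.2 * k n p.1 (w n p.1 p.2))) n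
  have hS : ∀ n, S (n + 1) = (w n (S n).1 (S n).2, (S n).2 * k n (S n).1 (w n (S n).1 (S n).2)) :=
    fun n => rfl
  have hSbad : ∀ n m, (S n).2 ∉ pathSubgroup U.toAddSubgroup k m n (S n).1 := fun n => by
    induction n with
    | zero => exact hbad
    | succ n ih => rw [hS]; exact hw n _ _ ih
  have hprod : ∀ n, (S n).2 =
      q * ((List.range n).map fun i => k i (S i).1 (S (i + 1)).1).prod := fun n => by
    induction n with
    | zero => simp [S]
    | succ n ih =>
      rw [List.range_succ, List.map_append, List.prod_append, ← mul_assoc, ← ih]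
      simp [hS]
  obtain ⟨n, hn⟩ := hT fun i => (S i).1
  rw [← hprod] at hn
  exact hSbad n 0 hn

end Paths

end Rings

/-! ### Lifting zero-convergent families of orthogonal idempotents -/

section Lifting

variable {R : Type w} [Ring R] [TopologicalSpace R]

/-- The element `a` is an isomorphism between the corners of the idempotents `e` and `f`. -/
def IsCornerIso {R : Type w} [Ring R] (e f a : R) : Prop :=
  e * a * f = a ∧ ∃ b, f * b * e = b ∧ a * b = e ∧ b * a = f

/-- A zero-convergent family of nonzero orthogonal idempotents with sum `1` in which the
noninvertible elements of the corners `e z * R * e w` are T-nilpotent. -/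
structure IsPerfectFamily {Z : Type*} (e : Z → R) : Prop where
  orthogonal : OrthogonalIdempotents e
  ne_zero : ∀ z, e z ≠ 0
  hasSum : HasSum e 1
  tNilpotent : ∀ (z : ℕ → Z) (a : ℕ → R), (∀ i, e (z i) * a i * e (z (i + 1)) = a i) →
    (∀ i, ¬ IsCornerIso (e (z i)) (e (z (i + 1))) (a i)) →
    Tendsto (fun n : ℕ => ((List.range (n + 1)).map a).prod) atTop (𝓝 0)

variable [IsTopologicalRing R] [IsLinearTopology Rᵐᵒᵖ R] [T2Space R]

/-- A row-convergent matrix `k` over a T-nilpotent set with `k * k = -k` vanishes. -/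
theorem matrix_eq_zero_of_tNilpotent {E : Set R} (hE : IsTopLeftTNilpotent E) {Z : Type*}
    (k : Z → Z → R) (hkE : ∀ w z, k w z ∈ E) (hk : ∀ w, ZeroConvergent (k w))
    (hkk : ∀ w z, HasSum (fun y => k w y * k y z) (-k w z)) (w z : Z) : k w z = 0 := by
  refine eq_zero_of_forall_mem fun U hU => ?_
  have hex : ∀ y, ∃ m, k w y ∈ pathSubgroup U.toAddSubgroup (fun _ => k) m 0 y := fun y => by
    refine exists_mem_pathSubgroup U _ hU (fun _ => hk) y _ fun s => ?_
    have h1 := (hE (fun i => k (s i) (s (i + 1))) fun _ => hkE _ _).const_mul (k w y)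
    rw [mul_zero] at h1
    obtain ⟨n, hn⟩ := (h1.eventually (hU.mem_nhds U.zero_mem)).exists
    exact ⟨n + 1, hn⟩
  choose m hm using hex
  obtain ⟨B, hB⟩ := (((hk w).finite_notMem hU).image m).bddAbove
  -- One length serves all `y`: almost every entry of row `w` is already in `U`.
  have hall : ∀ y, k w y ∈ pathSubgroup U.toAddSubgroup (fun _ => k) B 0 y := fun y => by
    by_cases hy : k w y ∈ U
    · exact pathSubgroup_mono U _ (Nat.zero_le B) _ _ hy
    · exact pathSubgroup_mono U _ (hB ⟨y, hy, rfl⟩) _ _ (hm y)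
  -- Since `k w y` is minus the sum of the `k w x * k x y`, membership for paths of length `B + 1`
  -- gives membership for length `B`.
  have descend : ∀ B n, (∀ y, k w y ∈ pathSubgroup U.toAddSubgroup (fun _ => k) B n y) →
      k w z ∈ U := by
    intro B
    induction B with
    | zero => exact fun n h => h z
    | succ B ih =>
      refine fun n h => ih (n + 1) fun y => neg_mem_iff.1 ?_
      exact mem_addSubgroup_of_hasSum (hkk w y)
        (isClosed_pathSubgroup (isClosed_of_isOpen_rightIdeal hU) _ _ _ _)
        fun x => mem_pathSubgroup_succ.1 (h x) y
  exact descend B 0 hall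

/-- A zero-convergent family which is orthogonal idempotent with sum `1` modulo a closed
T-nilpotent ideal can be corrected to a family of orthogonal idempotents with sum `1`. -/
theorem exists_orthogonal_lift (hc : IsCompleteGroup R) (H : Ideal R) [H.IsTwoSided]
    (hcl : IsClosed (H : Set R)) (hT : IsTopLeftTNilpotent (H : Set R)) {Z : Type*} [DecidableEq Z]
    (a : Z → R) (horth : ∀ w z, a w * a z - (if w = z then a w else 0) ∈ H) {u : R}
    (ha : HasSum a u) (hu : u - 1 ∈ H) :
    ∃ e : Z → R, OrthogonalIdempotents e ∧ HasSum e 1 ∧ ∀ z, e z - a z ∈ H := by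
  have hidem : ∀ z, a z * a z - a z ∈ H := fun z => by simpa using horth z z
  choose f hff hfa using fun z => exists_idempotent_lift hc H hcl (fun h hh => hT.tendsto_pow hh)
    (a z) (hidem z)
  have haf : ∀ z, a z * f z - a z ∈ H := fun z => by
    have := H.add_mem (H.mul_mem_left (a z) (hfa z)) (hidem z)
    simpa [mul_sub] using this
  -- The idempotents `f z` themselves need not converge to zero, but `a z * f z` does, and it still
  -- ends in `f z`.
  obtain ⟨s, hs⟩ := exists_hasSum_ring hc ((zeroConvergent_of_hasSum ha).mul f)
  have hsH : 1 - s ∈ H := by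
    have h1 : s - u ∈ H :=
      mem_addSubgroup_of_hasSum (hs.sub ha) (U := H.toAddSubgroup) hcl haf
    have := H.neg_mem (H.add_mem h1 hu)
    simpa using this
  obtain ⟨t, hst, hts⟩ := exists_inv_one_sub hc (hT.tendsto_pow hsH)
  rw [sub_sub_cancel] at hst hts
  have htH : t - 1 ∈ H := by
    have := H.mul_mem_left t hsH
    rwa [mul_sub, mul_one, hts] at this
  let b : Z → R := fun z => t * (a z * f z)
  have hb : HasSum b 1 := by simpa only [hts] using hs.mul_left t
  have hbf : ∀ z, b z * f z = b z := fun z => by simp only [b, mul_assoc, hff]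
  have hba : ∀ z, b z - a z ∈ H := fun z => by
    have := H.add_mem (H.mul_mem_right (a z * f z) htH) (haf z)
    simpa [b, sub_mul] using this
  -- The defect of the relation `f w * b z = δ * f w`. Its rows sum to `0` because the `b z` sum to
  -- `1`; multiplying this by `b z` gives `k * k = -k`.
  let k : Z → Z → R := fun w z => f w * b z - if w = z then f w else 0
  have hkH : ∀ w z, k w z ∈ H := fun w z => by
    have h1 : f w * b z - a w * a z ∈ H := by
      have := H.add_mem (H.mul_mem_left (f w) (hba z)) (H.mul_mem_right (a z) (hfa w))
      simpa [mul_sub, sub_mul] using this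
    have h2 : (if w = z then a w else 0) - (if w = z then f w else 0) ∈ H := by
      split_ifs
      · simpa using H.neg_mem (hfa w)
      · simp
    have := H.add_mem (H.add_mem h1 (horth w z)) h2
    simpa [k] using this
  have hks : ∀ w, HasSum (k w) 0 := fun w => by
    have h1 := (hb.mul_left (f w)).sub (hasSum_ite_eq w (f w))
    simpa [k, eq_comm] using h1
  have hkf : ∀ w z, k w z * f z = k w z := fun w z => by
    simp only [k, sub_mul, mul_assoc, hbf]
    split_ifs with h
    · rw [← h, hff]
    · simp
  have hk0 : ∀ w z, k w z = 0 := by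
    refine matrix_eq_zero_of_tNilpotent hT k hkH
      (fun w => zeroConvergent_of_hasSum (hks w)) fun w z => ?_
    have h1 := ((hks w).mul_right (b z)).sub (hasSum_ite_eq z (k w z))
    simp only [zero_mul, zero_sub] at h1
    have h2 : ∀ y, k w y * k y z = k w y * b z - if y = z then k w z else 0 := fun y => by
      change k w y * (f y * b z - if y = z then f y else 0) = _
      rw [mul_sub, ← mul_assoc, hkf]
      split_ifs with h
      · rw [hkf, h]
      · rw [mul_zero]
    simpa only [h2] using h1
  have hfb : ∀ w z, f w * b z = if w = z then f w else 0 := fun w z => sub_eq_zero.1 (hk0 w z)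
  refine ⟨b, ⟨fun z => ?_, fun z w hzw => ?_⟩, hb, hba⟩
  · rw [IsIdempotentElem]
    nth_rw 1 [← hbf z]
    rw [mul_assoc, hfb, if_pos rfl, hbf]
  · change b z * b w = 0
    rw [← hbf z, mul_assoc, hfb, if_neg hzw, mul_zero]

end Lifting

/-! ### Idempotents in topologically semisimple rings -/

section MatrixUnits

variable {D : Type*} [DivisionRing D] {Y : Type*}

/-- The endomorphism `v ↦ single y' (v y * d)` of a vector space with a basis. -/
def matrixUnit (y y' : Y) (d : D) : Module.End D (Y →₀ D) :=
  Finsupp.lsingle y' ∘ₗ LinearMap.toSpanSingleton D D d ∘ₗ Finsupp.lapply y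

theorem matrixUnit_apply (y y' : Y) (d : D) (v : Y →₀ D) :
    matrixUnit y y' d v = Finsupp.single y' (v y * d) := rfl

theorem matrixUnit_mul (y y' y'' : Y) (d d' : D) :
    matrixUnit y' y'' d' * matrixUnit y y' d = matrixUnit y y'' (d * d') := by
  refine LinearMap.ext fun v => ?_
  simp [matrixUnit_apply, mul_assoc]

theorem matrixUnit_mul_of_ne {y y' u u' : Y} (h : y' ≠ u) (d d' : D) :
    matrixUnit u u' d' * matrixUnit y y' d = 0 := by
  refine LinearMap.ext fun v => ?_
  simp [matrixUnit_apply, Finsupp.single_eq_of_ne' h]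

/-- Each corner between coordinate idempotents is a copy of `D`: only one matrix coefficient
survives. -/
theorem matrixUnit_mul_mul (y y' : Y) (f : Module.End D (Y →₀ D)) :
    matrixUnit y' y' 1 * f * matrixUnit y y 1 =
      matrixUnit y y' (f (Finsupp.single y 1) y') := by
  refine LinearMap.ext fun v => ?_
  have : Finsupp.single y (v y) = v y • Finsupp.single y (1 : D) := by simp
  simp only [Module.End.mul_apply, matrixUnit_apply, mul_one]
  rw [this, map_smul, Finsupp.smul_apply, smul_eq_mul]

theorem matrixUnit_one_ne_zero (y : Y) : matrixUnit y y (1 : D) ≠ 0 := fun h => by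
  have := DFunLike.congr_fun h (Finsupp.single y 1)
  simp [matrixUnit_apply] at this

end MatrixUnits

/-! ### Coordinate idempotents in products of endomorphism rings. -/

section Semisimple

attribute [local instance] finiteTopology

theorem hasSum_finiteTopology {A M : Type*} [Ring A] [AddCommGroup M] [Module A M] {Z : Type*}
    {f : Z → Module.End A M} {g : Module.End A M}
    (h : ∀ v, ∃ F : Finset Z, ∀ F', F ⊆ F' → ∑ z ∈ F', f z v = g v) : HasSum f g := by
  let _ : TopologicalSpace M := ⊥
  rw [HasSum, SummationFilter.unconditional_filter]
  rw [nhds_induced, tendsto_comap_iff]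
  refine tendsto_pi_nhds.2 fun v => ?_
  obtain ⟨F, hF⟩ := h v
  refine tendsto_nhds_of_eventually_eq (mem_atTop_sets.2 ⟨F, fun F' hF' => ?_⟩)
  simpa using hF F' hF'

variable {X : Type w} (Y : X → Type w) (D : X → Type w) [∀ x, DivisionRing (D x)]

/-- The coordinate idempotents in a product of endomorphism rings of vector spaces. -/
def coordIdempotent [DecidableEq X] (z : Σ x, Y x) :
    (x : X) → (Module.End (D x) (Y x →₀ D x))ᵐᵒᵖ :=
  Pi.single z.1 (MulOpposite.op (matrixUnit z.2 z.2 1))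

variable [DecidableEq X]

theorem coordIdempotent_apply_self (x : X) (y : Y x) :
    coordIdempotent Y D ⟨x, y⟩ x = MulOpposite.op (matrixUnit y y 1) :=
  Pi.single_eq_same _ _

theorem coordIdempotent_apply_of_ne {x x' : X} (h : x ≠ x') (y : Y x) :
    coordIdempotent Y D ⟨x, y⟩ x' = 0 :=
  Pi.single_eq_of_ne' h _

theorem orthogonal_coordIdempotent : OrthogonalIdempotents (coordIdempotent Y D) where
  idem := fun ⟨x, y⟩ => by
    rw [IsIdempotentElem, coordIdempotent, ← Pi.single_mul, ← MulOpposite.op_mul, matrixUnit_mul,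
      mul_one]
  ortho := fun ⟨x, y⟩ ⟨x', y'⟩ h => by
    change coordIdempotent Y D _ * coordIdempotent Y D _ = 0
    by_cases hx : x = x'
    · subst hx
      have hy : y ≠ y' := fun hy => h (by rw [hy])
      simp only [coordIdempotent]
      rw [← Pi.single_mul, ← MulOpposite.op_mul, matrixUnit_mul_of_ne hy]
      simp
    · funext x''
      by_cases hx' : x = x''
      · subst hx'
        rw [Pi.mul_apply, coordIdempotent_apply_of_ne Y D (Ne.symm hx), mul_zero, Pi.zero_apply]
      · rw [Pi.mul_apply, coordIdempotent_apply_of_ne Y D hx', zero_mul, Pi.zero_apply]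

theorem coordIdempotent_ne_zero (z : Σ x, Y x) : coordIdempotent Y D z ≠ 0 := fun h => by
  have := congr_fun h z.1
  rw [coordIdempotent_apply_self] at this
  exact matrixUnit_one_ne_zero z.2 (MulOpposite.op_injective this)

theorem hasSum_coordIdempotent : HasSum (coordIdempotent Y D) 1 := by
  classical
  refine Pi.hasSum.2 fun x => ?_
  have : HasSum (fun z => (coordIdempotent Y D z x).unop) (1 : Module.End (D x) (Y x →₀ D x)) := by
    -- Only the coordinates in the support of `v` contribute to the value at `v`.
    refine hasSum_finiteTopology fun v => ⟨v.support.map ⟨Sigma.mk x, sigma_mk_injective⟩, ?_⟩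
    intro F hF
    rw [← Finset.sum_subset hF, Finset.sum_map]
    · simp only [Function.Embedding.coeFn_mk, coordIdempotent_apply_self, MulOpposite.unop_op,
        matrixUnit_apply, mul_one]
      exact v.sum_single
    · rintro ⟨x', y⟩ - hy
      by_cases hx : x' = x
      · subst hx
        have : v y = 0 := by simpa using hy
        simp [coordIdempotent_apply_self, matrixUnit_apply, this]
      · simp [coordIdempotent_apply_of_ne Y D hx]
  exact this.op

/-- Corners between different factors vanish; within one factor `a` is a matrix unit with
coefficient `d ≠ 0`, inverted by the one with coefficient `d⁻¹`. -/
theorem isCornerIso_coordIdempotent (z w : Σ x, Y x)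
    (a : (x : X) → (Module.End (D x) (Y x →₀ D x))ᵐᵒᵖ)
    (ha : coordIdempotent Y D z * a * coordIdempotent Y D w = a) (ha0 : a ≠ 0) :
    IsCornerIso (coordIdempotent Y D z) (coordIdempotent Y D w) a := by
  obtain ⟨x, y⟩ := z
  obtain ⟨x', y'⟩ := w
  have hx : x = x' := by
    by_contra hx
    refine ha0 (ha ▸ funext fun x'' => ?_)
    by_cases hx' : x = x''
    · subst hx'
      rw [Pi.mul_apply, coordIdempotent_apply_of_ne Y D (Ne.symm hx), mul_zero, Pi.zero_apply]
    · rw [Pi.mul_apply, Pi.mul_apply, coordIdempotent_apply_of_ne Y D hx', zero_mul, zero_mul,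
        Pi.zero_apply]
  subst hx
  obtain ⟨d, hd⟩ : ∃ d, a = Pi.single x (MulOpposite.op (matrixUnit y y' d)) := by
    refine ⟨(a x).unop (Finsupp.single y 1) y', ?_⟩
    rw [← matrixUnit_mul_mul]
    funext x''
    by_cases hx' : x = x''
    · subst hx'
      conv_lhs => rw [← ha]
      simp [Pi.mul_apply, coordIdempotent_apply_self, mul_assoc]
    · conv_lhs => rw [← ha]
      rw [Pi.mul_apply, Pi.mul_apply, coordIdempotent_apply_of_ne Y D hx', zero_mul, zero_mul,
        Pi.single_eq_of_ne' hx']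
  have hd0 : d ≠ 0 := by
    rintro rfl
    refine ha0 ?_
    have : matrixUnit y y' (0 : D x) = 0 := LinearMap.ext fun v => by simp [matrixUnit_apply]
    simp [hd, this]
  refine ⟨ha, Pi.single x (MulOpposite.op (matrixUnit y' y d⁻¹)), ?_, ?_, ?_⟩
  · simp only [coordIdempotent, ← Pi.single_mul, ← MulOpposite.op_mul, matrixUnit_mul, one_mul,
      mul_one]
  · simp only [hd, coordIdempotent, ← Pi.single_mul, ← MulOpposite.op_mul, matrixUnit_mul,
      mul_inv_cancel₀ hd0]
  · simp only [hd, coordIdempotent, ← Pi.single_mul, ← MulOpposite.op_mul, matrixUnit_mul,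
      inv_mul_cancel₀ hd0]

/-- A topologically semisimple ring has a decomposition of the unit into orthogonal idempotents
all of whose nonzero corner elements are invertible. -/
theorem IsTopSemisimple.exists_idempotents {S : Type w} [Ring S] [TopologicalSpace S]
    (hS : IsTopSemisimple S) :
    ∃ (Z : Type w) (e : Z → S), OrthogonalIdempotents e ∧ (∀ z, e z ≠ 0) ∧ HasSum e 1 ∧
      ∀ z w a, e z * a * e w = a → a ≠ 0 → IsCornerIso (e z) (e w) a := by
  classical
  obtain ⟨X, Y, D, _, -, φ, hφ⟩ := hS
  refine ⟨Σ x, Y x, fun z => φ.symm (coordIdempotent Y D z),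
    (orthogonal_coordIdempotent Y D).map φ.symm.toRingHom, fun z => ?_, ?_, ?_⟩
  · simpa using coordIdempotent_ne_zero Y D z
  · have hcont : Continuous φ.symm := φ.toEquiv.continuous_symm_iff.2 hφ.isOpenMap
    have := (hasSum_coordIdempotent Y D).map φ.symm hcont
    rwa [map_one] at this
  · intro z w a ha ha0
    obtain ⟨h1, b, h2, h3, h4⟩ := isCornerIso_coordIdempotent Y D z w (φ a)
      (by simpa using congrArg φ ha) (by simpa using ha0)
    exact ⟨ha, φ.symm b, by simpa using congrArg φ.symm h2, by simpa using congrArg φ.symm h3,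
      by simpa using congrArg φ.symm h4⟩

end Semisimple

/-! ### Perfect families of idempotents in topologically left perfect rings -/

section PerfectFamily

variable {R : Type w} [Ring R]

/-- A corner element which is invertible modulo an ideal of quasi-invertible elements is
invertible. -/
theorem isCornerIso_of_mem (H : Ideal R) [H.IsTwoSided]
    (hH : ∀ h ∈ H, ∃ b, (1 - h) * b = 1 ∧ b * (1 - h) = 1) {e f a b : R}
    (he : e * e = e) (hf : f * f = f) (ha : e * a * f = a) (hab : a * b - e ∈ H)
    (hba : b * a - f ∈ H) : IsCornerIso e f a := by
  have hea : e * a = a := by rw [← ha, ← mul_assoc, ← mul_assoc, he]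
  have haf : a * f = a := by rw [← ha, mul_assoc, hf]
  have h1 : e - a * b * e ∈ H := by
    have := H.neg_mem (H.mul_mem_right e hab)
    simpa [sub_mul, he] using this
  have h2 : f - f * b * a ∈ H := by
    have := H.neg_mem (H.mul_mem_left f hba)
    simpa [mul_sub, hf, mul_assoc] using this
  -- Since `e * (1 - (e - a * b * e)) = a * b * e`, inverting the second factor produces a right
  -- inverse of `a`; `s` produces a left inverse in the mirror way, and `h7` identifies the two.
  obtain ⟨t, ht, -⟩ := hH _ h1
  obtain ⟨s, -, hs⟩ := hH _ h2
  have h3 : a * b * e * t = e := by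
    have : e * (1 - (e - a * b * e)) = a * b * e := by
      simp only [mul_sub, ← mul_assoc, he, hea, mul_one]; abel
    rw [← this, mul_assoc, ht, mul_one]
  have h4 : s * (f * b * a) = f := by
    have : (1 - (f - f * b * a)) * f = f * b * a := by
      simp only [sub_mul, mul_assoc, hf, haf, one_mul]; abel
    rw [← this, ← mul_assoc, hs, one_mul]
  have h5 : a * (f * b * e * t * e) = e := by
    simp only [← mul_assoc, haf]
    rw [h3, he]
  have h6 : f * s * f * b * e * a = f := by
    simp only [mul_assoc, hea] at h4 ⊢
    rw [h4, hf]
  have h7 : f * b * e * t * e = f * s * f * b * e := by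
    have h8 : f * (f * b * e * t * e) = f * b * e * t * e := by simp only [← mul_assoc, hf]
    rw [← h8]
    nth_rw 1 [← h6]
    rw [mul_assoc, h5]
    simp only [mul_assoc, he]
  refine ⟨ha, f * b * e * t * e, ?_, h5, by rw [h7, h6]⟩
  simp only [← mul_assoc, hf]
  rw [mul_assoc, he]

variable [TopologicalSpace R] [IsTopologicalRing R] [IsLinearTopology Rᵐᵒᵖ R] [T2Space R]

theorem IsTopLeftPerfect.exists_isPerfectFamily (hc : IsCompleteGroup R)
    (hR : IsTopLeftPerfect R) : ∃ (Z : Type w) (e : Z → R), IsPerfectFamily e := by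
  classical
  obtain ⟨Z, s, hso, hs0, hs1, hsc⟩ := hR.semisimple.exists_idempotents
  have hcl := hR.stronglyClosed.isClosed
  obtain ⟨a, ha, has⟩ := hR.stronglyClosed.exists_lift Z s
    (zeroConvergent_of_hasSum (A := R ⧸ (topJacobson R).toAddSubgroup) hs1)
  replace has : ∀ z, Ideal.Quotient.mk (topJacobson R) (a z) = s z := has
  obtain ⟨u, hu⟩ := exists_hasSum_ring hc ha
  have hu1 : u - 1 ∈ topJacobson R := by
    rw [← Ideal.Quotient.eq, map_one]
    have h1 : HasSum s (Ideal.Quotient.mk (topJacobson R) u) := by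
      have := hu.map (Ideal.Quotient.mk (topJacobson R)) 
        (continuous_quot_mk :
          Continuous (QuotientAddGroup.mk : R → R ⧸ (topJacobson R).toAddSubgroup))
      rwa [show _ ∘ a = s from funext has] at this
    -- Closedness of the radical makes the quotient Hausdorff, so the two sums of `s` agree.
    have := hcl
    have : T2Space (R ⧸ topJacobson R) :=
      inferInstanceAs (T2Space (R ⧸ (topJacobson R).toAddSubgroup))
    exact h1.unique hs1
  obtain ⟨e, heo, he1, hea⟩ := exists_orthogonal_lift hc (topJacobson R) hcl hR.tNilpotent a
    (fun w z => by
      rw [← Ideal.Quotient.eq_zero_iff_mem]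
      split_ifs with h
      · subst h
        simp [has, (hso.idem w).eq]
      · simp [has, hso.ortho h]) hu hu1
  have hes : ∀ z, Ideal.Quotient.mk (topJacobson R) (e z) = s z := fun z => by
    rw [← has, Ideal.Quotient.eq]; exact hea z
  refine ⟨Z, e, heo, fun z hz => hs0 z (by rw [← hes, hz, map_zero]), he1, fun z b hb hiso =>
    hR.tNilpotent b fun i => ?_⟩
  -- Outside the radical, `b i` has a nonzero and hence invertible image in its corner, and
  -- invertibility lifts.
  by_contra hbi
  refine hiso i ?_
  obtain ⟨-, c, -, hc1, hc2⟩ := hsc (z i) (z (i + 1)) (Ideal.Quotient.mk _ (b i))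
    (by rw [← hes, ← hes, ← map_mul, ← map_mul, hb])
    (fun h => hbi (Ideal.Quotient.eq_zero_iff_mem.1 h))
  obtain ⟨c, rfl⟩ := Ideal.Quotient.mk_surjective c
  refine isCornerIso_of_mem (topJacobson R)
    (fun h hh => exists_inv_one_sub hc (hR.tNilpotent.tendsto_pow hh)) (heo.idem _) (heo.idem _)
    (hb i) (b := c) ?_ ?_
  · rw [← Ideal.Quotient.eq, map_mul, hc1, hes]
  · rw [← Ideal.Quotient.eq, map_mul, hc2, hes]

end PerfectFamily

/-! ### The radical of a ring with a perfect family of idempotents -/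

section Corners

variable {R : Type w} [Ring R]

theorem IsCornerIso.symm {e f a : R} (h : IsCornerIso e f a) :
    ∃ b, IsCornerIso f e b ∧ a * b = e ∧ b * a = f := by
  obtain ⟨h1, b, h2, h3, h4⟩ := h
  exact ⟨b, ⟨h2, a, h1, h4, h3⟩, h3, h4⟩

theorem IsCornerIso.left_mul {e f a : R} (he : e * e = e) (h : IsCornerIso e f a) : e * a = a := by
  rw [← h.1, ← mul_assoc, ← mul_assoc, he]

theorem IsCornerIso.mul_right {e f a : R} (hf : f * f = f) (h : IsCornerIso e f a) : a * f = a := by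
  rw [← h.1, mul_assoc, hf]

theorem IsCornerIso.trans {e f g a b : R} (he : e * e = e) (hg : g * g = g)
    (h : IsCornerIso e f a) (h' : IsCornerIso f g b) : IsCornerIso e g (a * b) := by
  have h1 := h.left_mul he
  have h2 := h'.mul_right hg
  obtain ⟨ha, c, hc, hac, hca⟩ := h
  obtain ⟨hb, d, hd, hbd, hdb⟩ := h'
  have h3 : g * d = d := by rw [← hd, ← mul_assoc, ← mul_assoc, hg]
  have h4 : c * e = c := by rw [← hc, mul_assoc, he]
  have h5 : a * f = a := by rw [← hca, ← mul_assoc, hac, h1]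
  have h6 : d * f = d := by rw [← hbd, ← mul_assoc, hdb, h3]
  refine ⟨by rw [← mul_assoc, h1, mul_assoc, h2], d * c, ?_, ?_, ?_⟩
  · rw [← mul_assoc, h3, mul_assoc, h4]
  · rw [mul_assoc, ← mul_assoc b, hbd, ← mul_assoc, h5, hac]
  · rw [mul_assoc, ← mul_assoc c, hca, ← mul_assoc, h6, hdb]

theorem isCornerIso_self {e : R} (he : e * e = e) : IsCornerIso e e e :=
  ⟨by rw [he, he], e, by rw [he, he], he, he⟩

theorem IsCornerIso.neg {e f a : R} (h : IsCornerIso e f a) : IsCornerIso e f (-a) := by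
  obtain ⟨ha, c, hc, hac, hca⟩ := h
  exact ⟨by simp [ha], -c, by simp [hc], by simp [hac], by simp [hca]⟩

theorem IsCornerIso.eq_of_idempotent {e p : R} (he : e * e = e) (h : IsCornerIso e e p)
    (hp : p * p = p) : p = e := by
  have h1 := h.left_mul he
  obtain ⟨-, c, -, -, hcp⟩ := h
  rw [← h1, ← hcp, mul_assoc, hp]

end Corners

/-! ### Local corners, row ideals and the radical. -/

namespace IsPerfectFamily

variable {R : Type w} [Ring R] [TopologicalSpace R] {Z : Type*} {e : Z → R}

theorem idem (h : IsPerfectFamily e) (z : Z) : e z * e z = e z := (h.orthogonal.idem z).eq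

theorem corner_mul (h : IsPerfectFamily e) (z w : Z) (x : R) :
    e z * (e z * x * e w) * e w = e z * x * e w := by
  rw [← mul_assoc, ← mul_assoc, h.idem, mul_assoc, h.idem]

variable [IsTopologicalRing R] [IsLinearTopology Rᵐᵒᵖ R] [T2Space R]

/-- The corner ring is local: T-nilpotency along the constant sequence `a` makes the geometric
series converge. -/
theorem isCornerIso_sub (h : IsPerfectFamily e) (hc : IsCompleteGroup R) {z : Z} {a : R}
    (ha : e z * a * e z = a) (hn : ¬ IsCornerIso (e z) (e z) a) :
    IsCornerIso (e z) (e z) (e z - a) := by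
  have ht : Tendsto (fun n : ℕ => a ^ n) atTop (𝓝 0) := by
    rw [← tendsto_add_atTop_iff_nat 1]
    simpa using h.tNilpotent (fun _ => z) (fun _ => a) (fun _ => ha) fun _ => hn
  obtain ⟨b, hb, hb'⟩ := exists_inv_one_sub hc ht
  have he := h.idem z
  have h1 : e z * a = a := by rw [← ha, ← mul_assoc, ← mul_assoc, he]
  have h2 : a * e z = a := by rw [← ha, mul_assoc, he]
  have h3 : e z * (1 - a) = e z - a := by rw [mul_sub, mul_one, h1]
  have h4 : (1 - a) * e z = e z - a := by rw [sub_mul, one_mul, h2]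
  refine ⟨?_, e z * b * e z, ?_, ?_, ?_⟩
  · rw [← h3, ← mul_assoc, he, mul_assoc, h4, mul_sub, he, h1, h3]
  · rw [← mul_assoc, ← mul_assoc, he, mul_assoc, he]
  · rw [← h3, mul_assoc, ← mul_assoc (1 - a), ← mul_assoc (1 - a), h4, ← h3]
    simp only [← mul_assoc, he]
    rw [mul_assoc (e z), hb, mul_one, he]
  · rw [← h4, mul_assoc, ← mul_assoc (e z), h3, ← h4]
    simp only [mul_assoc, he]
    rw [← mul_assoc b, hb', one_mul, he]

/-- With `c` inverse to `a * b`, the element `b * c * a` is an idempotent of the local corner at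
`w`, so it is `e w` or `0`. In the first case `b * c` inverts `a`; the second would force `e z = 0`.
-/
theorem isCornerIso_left (h : IsPerfectFamily e) (hc : IsCompleteGroup R) {z w u : Z} {a b : R}
    (ha : e z * a * e w = a) (hb : e w * b * e u = b)
    (hab : IsCornerIso (e z) (e u) (a * b)) : IsCornerIso (e z) (e w) a := by
  obtain ⟨c, hcu, hc1, -⟩ := hab.symm
  have hbw : e w * b = b := by rw [← hb, ← mul_assoc, ← mul_assoc, h.idem]
  have hcz := hcu.mul_right (h.idem z)
  have hcorner : e w * (b * c * a) * e w = b * c * a := by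
    rw [← mul_assoc, ← mul_assoc, hbw, mul_assoc, ← ha]
    simp only [mul_assoc, h.idem]
  have hp : (b * c * a) * (b * c * a) = b * c * a := by
    have : (b * c * a) * (b * c * a) = b * c * (a * b * c) * a := by simp only [mul_assoc]
    rw [this, hc1, mul_assoc b c, hcz]
  have hea : e z * a = a := by rw [← ha, ← mul_assoc, ← mul_assoc, h.idem]
  by_cases hiso : IsCornerIso (e w) (e w) (b * c * a)
  · refine ⟨ha, b * c, ?_, by rw [← mul_assoc, hc1], hiso.eq_of_idempotent (h.idem w) hp⟩
    rw [← mul_assoc, hbw, mul_assoc, hcz]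
  · have h1 := h.isCornerIso_sub hc hcorner hiso
    have h2 : e w * (b * c * a) = b * c * a := by rw [← hcorner, ← mul_assoc, ← mul_assoc, h.idem]
    have h3 : b * c * a * e w = b * c * a := by rw [← hcorner, mul_assoc, h.idem]
    have h4 := h1.eq_of_idempotent (h.idem w) (by
      rw [mul_sub, sub_mul, sub_mul, hp, h.idem, h2, h3]; abel)
    have h5 : b * c * a = 0 := by simpa using h4
    refine absurd ?_ (h.ne_zero z)
    rw [← h.idem z]
    nth_rw 1 [← hc1]
    rw [← hc1]
    have : a * b * c * (a * b * c) = a * (b * c * a) * b * c := by simp only [mul_assoc]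
    rw [this, h5]
    simp

/-- The elements whose `(z, w)`-component is not invertible. -/
def cornerRadical (h : IsPerfectFamily e) (hc : IsCompleteGroup R) (z w : Z) : AddSubgroup R where
  carrier := {a | ¬ IsCornerIso (e z) (e w) (e z * a * e w)}
  zero_mem' := fun ⟨_, b, _, h1, _⟩ => h.ne_zero z (by simpa using h1.symm)
  neg_mem' := fun {a} ha ha' => ha (by simpa using ha'.neg)
  add_mem' := fun {a b} ha hb hab => by
    obtain ⟨c, hcw, hc1, hc2⟩ := hab.symm
    have hprod : ∀ x, e z * (e z * x * e w * c) * e z = e z * x * e w * c := fun x => by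
      simp only [← mul_assoc, h.idem]
      rw [mul_assoc, hcw.mul_right (h.idem z)]
    -- The two components times `c` add up to `e z`. The first product is noninvertible, so by
    -- locality the second is invertible, and then so is the component of `b`.
    have h1 : ¬ IsCornerIso (e z) (e z) (e z * a * e w * c) := fun h1 =>
      ha (h.isCornerIso_left hc (h.corner_mul z w a) hcw.1 h1)
    have h2 := h.isCornerIso_sub hc (hprod a) h1
    have h3 : e z - e z * a * e w * c = e z * b * e w * c := by
      nth_rw 1 [← hc1]
      noncomm_ring
    rw [h3] at h2
    exact hb (h.isCornerIso_left hc (h.corner_mul z w b) hcw.1 h2)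

variable (h : IsPerfectFamily e) (hc : IsCompleteGroup R)

/-- Take an open right ideal missing `e z`: if it contained `e z * a`, an invertible component of
`a` would bring `e z` into it. The choice is independent of `w`, which makes the row ideal open. -/
theorem exists_open_le_cornerRadical (z : Z) :
    ∃ U : AddSubgroup R, IsOpen (U : Set R) ∧ ∀ w, U ≤ h.cornerRadical hc z w := by
  obtain ⟨U, hU, hUz⟩ := exists_open_rightIdeal
    (isOpen_ne.mem_nhds (h.ne_zero z).symm : {b | b ≠ e z} ∈ 𝓝 (0 : R))
  refine ⟨U.toAddSubgroup.comap (AddMonoidHom.mulLeft (e z)),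
    hU.preimage (continuous_const_mul (e z)), fun w a ha hiso => ?_⟩
  obtain ⟨-, b, -, hb, -⟩ := hiso
  refine hUz ?_ rfl
  rw [← hb]
  exact mul_mem_rightIdeal U (mul_mem_rightIdeal U ha _) _

theorem isClosed_cornerRadical (z w : Z) : IsClosed (h.cornerRadical hc z w : Set R) := by
  obtain ⟨U, hU, hle⟩ := h.exists_open_le_cornerRadical hc z
  exact AddSubgroup.isClosed_of_isOpen _ (AddSubgroup.isOpen_mono (hle w) hU)

/-- The elements whose `z`-th row consists of noninvertible components: an open maximal right
ideal. -/
def rowIdeal (z : Z) : Submodule Rᵐᵒᵖ R where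
  __ := ⨅ w, h.cornerRadical hc z w
  smul_mem' := fun s r hr => by
    simp only [AddSubsemigroup.mem_carrier, AddSubmonoid.mem_toSubsemigroup,
      AddSubgroup.mem_toAddSubmonoid, AddSubgroup.mem_iInf, MulOpposite.smul_eq_mul_unop] at hr ⊢
    intro w
    -- Inserting `1 = ∑ e u` splits each component of `r * s` into products whose left factor is a
    -- noninvertible component of `r`.
    have hsum : HasSum (fun u => r * e u * s.unop) (r * s.unop) := by
      simpa using (h.hasSum.mul_left r).mul_right s.unop
    refine mem_addSubgroup_of_hasSum hsum (h.isClosed_cornerRadical hc z w) fun u hiso => hr u ?_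
    refine h.isCornerIso_left hc (h.corner_mul z u r) (h.corner_mul u w s.unop) ?_
    convert hiso using 1
    simp only [mul_assoc]
    rw [← mul_assoc (e u) (e u), h.idem]

theorem mem_rowIdeal {z : Z} {r : R} :
    r ∈ h.rowIdeal hc z ↔ ∀ w, ¬ IsCornerIso (e z) (e w) (e z * r * e w) :=
  AddSubgroup.mem_iInf

theorem isOpen_rowIdeal (z : Z) : IsOpen (h.rowIdeal hc z : Set R) := by
  obtain ⟨U, hU, hle⟩ := h.exists_open_le_cornerRadical hc z
  exact AddSubgroup.isOpen_mono (H₂ := (h.rowIdeal hc z).toAddSubgroup)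
    (fun a ha => (h.mem_rowIdeal hc).2 fun w => hle w ha) hU

theorem mem_rowIdeal_of_mul_eq_zero {z : Z} {r : R} (hr : e z * r = 0) : r ∈ h.rowIdeal hc z := by
  refine (h.mem_rowIdeal hc).2 fun w hiso => (h.cornerRadical hc z w).zero_mem ?_
  rw [hr] at hiso
  simpa using hiso

theorem isCoatom_rowIdeal (z : Z) : IsCoatom (h.rowIdeal hc z) := by
  refine ⟨fun htop => ?_, fun K hK => ?_⟩
  · have : (1 : R) ∈ h.rowIdeal hc z := htop ▸ Submodule.mem_top
    refine (h.mem_rowIdeal hc).1 this z ?_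
    rw [mul_one, h.idem]
    exact isCornerIso_self (h.idem z)
  · obtain ⟨hle, r, hrK, hr⟩ := SetLike.lt_iff_le_and_exists.1 hK
    rw [h.mem_rowIdeal hc] at hr
    push Not at hr
    obtain ⟨w, -, b, hb1, hb2, -⟩ := hr
    -- Here `b` inverts an invertible component of `r`, so `e z` annihilates this element from the
    -- left.
    have h1 : 1 - r * (e w * b) ∈ h.rowIdeal hc z := by
      refine h.mem_rowIdeal_of_mul_eq_zero hc ?_
      rw [mul_sub, mul_one, ← mul_assoc, ← mul_assoc, hb2, sub_self]
    have h2 : (1 : R) ∈ K := by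
      simpa using K.add_mem (hle h1) (mul_mem_rightIdeal K hrK (e w * b))
    refine (Submodule.eq_top_iff').2 fun x => ?_
    simpa using mul_mem_rightIdeal K h2 x

/-- Each `a n` is expanded into its components, which are noninvertible, so their products along any
path tend to zero. König's lemma bounds the length needed from each starting index `z`, and the
bound is uniform because almost all `e z` lie in `U`. -/
theorem isTopLeftTNilpotent_rows : IsTopLeftTNilpotent {r | ∀ z, r ∈ h.rowIdeal hc z} := by
  intro a ha W hW
  obtain ⟨U, hU, hUW⟩ := exists_open_rightIdeal hW
  let k : ℕ → Z → Z → R := fun n z w => e z * a n * e w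
  have hk : ∀ n z, ZeroConvergent (k n z) := fun n z =>
    (zeroConvergent_of_hasSum h.hasSum).const_mul _
  have hex : ∀ z, ∃ m, e z ∈ pathSubgroup U.toAddSubgroup k m 0 z := fun z => by
    refine exists_mem_pathSubgroup U k hU hk z _ fun s => ?_
    have h1 := (h.tNilpotent s (fun i => k i (s i) (s (i + 1))) (fun i => h.corner_mul _ _ _)
      fun i => (h.mem_rowIdeal hc).1 (ha i (s i)) _).const_mul (e z)
    rw [mul_zero] at h1
    obtain ⟨n, hn⟩ := (h1.eventually (hU.mem_nhds U.zero_mem)).exists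
    exact ⟨n + 1, hn⟩
  -- The component bound passes to the full product by summing over the next index; `U` is closed.
  have hpath : ∀ m n z q, q * e z = q → q ∈ pathSubgroup U.toAddSubgroup k m n z →
      q * ((List.range m).map fun i => a (n + i)).prod ∈ U := by
    intro m
    induction m with
    | zero => intro n z q _ hq; simpa using (show q ∈ U from hq)
    | succ m ih =>
      intro n z q hqz hq
      have hprod : ((List.range (m + 1)).map fun i => a (n + i)).prod =
          a n * ((List.range m).map fun i => a (n + 1 + i)).prod := by
        simp [List.range_succ_eq_map, Function.comp_def, add_assoc, Nat.add_comm 1]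
      rw [hprod]
      have hsum := ((h.hasSum.mul_left (q * a n)).mul_right
        ((List.range m).map fun i => a (n + 1 + i)).prod)
      rw [mul_one, mul_assoc q] at hsum
      refine mem_addSubgroup_of_hasSum hsum (isClosed_of_isOpen_rightIdeal hU) fun w => ?_
      have h1 := ih (n + 1) w (q * k n z w) (by simp only [k, mul_assoc, h.idem])
        (mem_pathSubgroup_succ.1 hq w)
      have h2 : q * k n z w = q * a n * e w := by
        simp only [k, ← mul_assoc, hqz]
      rwa [h2] at h1
  choose m hm using hex
  obtain ⟨B, hB⟩ := (((zeroConvergent_of_hasSum h.hasSum).finite_notMem hU).image m).bddAbove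
  have hBU : ((List.range B).map a).prod ∈ U := by
    have hsum := h.hasSum.mul_right ((List.range B).map a).prod
    rw [one_mul] at hsum
    refine mem_addSubgroup_of_hasSum hsum (isClosed_of_isOpen_rightIdeal hU) fun z => ?_
    by_cases hz : e z ∈ U
    · exact mul_mem_rightIdeal U hz _
    · have := hpath B 0 z (e z) (h.idem z) (pathSubgroup_mono U k (hB ⟨z, hz, rfl⟩) _ _ (hm z))
      simpa using this
  refine mem_map.2 (mem_atTop_sets.2 ⟨B, fun n hn => hUW ?_⟩)
  obtain ⟨d, hd⟩ := Nat.exists_eq_add_of_le (hn.trans n.le_succ)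
  change ((List.range n.succ).map a).prod ∈ U
  rw [hd, List.range_add, List.map_append, List.prod_append]
  exact mul_mem_rightIdeal U hBU _

/-- If `r` lies in all row ideals but not in a maximal `I`, then `1 = i + t • r` with `i ∈ I`.
Powers of `t • r` tend to zero, so `i` is invertible and `I` is everything. -/
theorem mem_topJacobson {r : R} : r ∈ topJacobson R ↔ ∀ z, r ∈ h.rowIdeal hc z := by
  refine ⟨fun hr z => hr _ (h.isOpen_rowIdeal hc z) (h.isCoatom_rowIdeal hc z),
    fun hr I hI hm => ?_⟩
  by_contra hrI
  have htop : I ⊔ Submodule.span Rᵐᵒᵖ {r} = ⊤ := by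
    refine hm.2 _ (lt_of_le_of_ne le_sup_left fun he => hrI ?_)
    rw [he]
    exact Submodule.mem_sup_right (Submodule.mem_span_singleton_self _)
  obtain ⟨i, hi, y, hy, hiy⟩ := Submodule.mem_sup.1 (htop ▸ Submodule.mem_top : (1 : R) ∈ _)
  obtain ⟨t, rfl⟩ := Submodule.mem_span_singleton.1 hy
  have hrt : ∀ z, t • r ∈ h.rowIdeal hc z := fun z => (h.rowIdeal hc z).smul_mem t (hr z)
  obtain ⟨b, hb, -⟩ := exists_inv_one_sub hc
    ((h.isTopLeftTNilpotent_rows hc).tendsto_pow (h := t • r) hrt)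
  have h1 : (1 : R) ∈ I := by
    rw [← hb, ← hiy, add_sub_cancel_right]
    exact mul_mem_rightIdeal I hi b
  refine hm.1 ((Submodule.eq_top_iff').2 fun x => ?_)
  simpa using mul_mem_rightIdeal I h1 x

theorem isTopLeftTNilpotent_topJacobson (h : IsPerfectFamily e) (hc : IsCompleteGroup R) :
    IsTopLeftTNilpotent (topJacobson R : Set R) := by
  have : (topJacobson R : Set R) = {r | ∀ z, r ∈ h.rowIdeal hc z} :=
    Set.ext fun r => h.mem_topJacobson hc
  rw [this]
  exact h.isTopLeftTNilpotent_rows hc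

theorem isClosed_topJacobson (h : IsPerfectFamily e) (hc : IsCompleteGroup R) :
    IsClosed (topJacobson R : Set R) := by
  have : (topJacobson R : Set R) = ⋂ z, (h.rowIdeal hc z : Set R) :=
    Set.ext fun r => by simpa using h.mem_topJacobson hc
  rw [this]
  exact isClosed_iInter fun z => isClosed_of_isOpen_rightIdeal (h.isOpen_rowIdeal hc z)

/-- Left multiplication by `e z` keeps row `z` and erases all the others. -/
theorem mem_rowIdeal_iff {z : Z} {r : R} : r ∈ h.rowIdeal hc z ↔ e z * r ∈ topJacobson R := by
  rw [h.mem_topJacobson hc, h.mem_rowIdeal hc]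
  refine ⟨fun hr z' => ?_, fun hr w => ?_⟩
  · by_cases hz : z' = z
    · subst hz
      refine (h.mem_rowIdeal hc).2 fun w => ?_
      rw [← mul_assoc, h.idem]
      exact hr w
    · refine h.mem_rowIdeal_of_mul_eq_zero hc ?_
      rw [← mul_assoc, h.orthogonal.ortho hz, zero_mul]
  · have := (h.mem_rowIdeal hc).1 (hr z) w
    rwa [← mul_assoc, h.idem] at this

theorem topJacobson_le_rowIdeal {z : Z} {r : R} (hr : r ∈ topJacobson R) : r ∈ h.rowIdeal hc z :=
  (h.mem_topJacobson hc).1 hr z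

end IsPerfectFamily

namespace IsPerfectFamily

/-! ### Strong closedness of the radical -/

variable {R : Type w} [Ring R] [TopologicalSpace R] [IsTopologicalRing R]
  [IsLinearTopology Rᵐᵒᵖ R] [T2Space R]

section StronglyClosed

variable {Z : Type*} {e : Z → R} (h : IsPerfectFamily e) (hc : IsCompleteGroup R)

/-- The image of an open right ideal in the quotient by the radical. -/
def quotientOpen (I : Submodule Rᵐᵒᵖ R) (hI : IsOpen (I : Set R)) :
    OpenAddSubgroup (R ⧸ (topJacobson R).toAddSubgroup) where
  toAddSubgroup := I.toAddSubgroup.map (QuotientAddGroup.mk' _)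
  isOpen' := QuotientAddGroup.isOpenMap_coe _ hI

theorem mk_mem_quotientOpen_rowIdeal {z : Z} {r : R} :
    (QuotientAddGroup.mk r : R ⧸ (topJacobson R).toAddSubgroup) ∈
      quotientOpen (h.rowIdeal hc z) (h.isOpen_rowIdeal hc z) ↔ r ∈ h.rowIdeal hc z := by
  refine ⟨fun ⟨r', hr', hrr'⟩ => ?_, fun hr => ⟨r, hr, rfl⟩⟩
  have h1 : -r' + r ∈ topJacobson R := QuotientAddGroup.eq.1 hrr'
  simpa using (h.rowIdeal hc z).add_mem hr' (h.topJacobson_le_rowIdeal hc (z := z) h1)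

/-- The limit is assembled row by row: `∑ e z * r z`, with `r z` representing the component of the
system at the `z`-th row ideal. -/
theorem isCompleteGroup_quotient (h : IsPerfectFamily e) (hc : IsCompleteGroup R) :
    IsCompleteGroup (R ⧸ (topJacobson R).toAddSubgroup) := by
  classical
  intro a ha
  let O : Z → OpenAddSubgroup (R ⧸ (topJacobson R).toAddSubgroup) := fun z =>
    quotientOpen (h.rowIdeal hc z) (h.isOpen_rowIdeal hc z)
  choose r hr using fun z => QuotientAddGroup.mk_surjective (a (O z))
  obtain ⟨s, hs⟩ := exists_hasSum_ring hc ((zeroConvergent_of_hasSum h.hasSum).mul r)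
  refine ⟨QuotientAddGroup.mk s, fun U => ?_⟩
  let P : AddSubgroup R := U.toAddSubgroup.comap (QuotientAddGroup.mk' _)
  have hP : IsOpen (P : Set R) := U.isOpen'.preimage continuous_quot_mk
  have hJP : ∀ j ∈ topJacobson R, j ∈ P := fun j hj => by
    have : (QuotientAddGroup.mk j : R ⧸ (topJacobson R).toAddSubgroup) = 0 :=
      (QuotientAddGroup.eq_zero_iff j).2 hj
    change (QuotientAddGroup.mk j : R ⧸ (topJacobson R).toAddSubgroup) ∈ U
    rw [this]
    exact U.zero_mem
  obtain ⟨V, hV, hVP⟩ := exists_open_rightIdeal (hP.mem_nhds P.zero_mem)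
  have hF := (zeroConvergent_of_hasSum h.hasSum).finite_notMem hV
  -- Fine enough to control the finitely many rows with `e z ∉ V`; the remaining rows land in `V`
  -- whatever the coefficients are.
  let I : Submodule Rᵐᵒᵖ R := V ⊓ ⨅ z ∈ hF.toFinset, h.rowIdeal hc z
  have hI : IsOpen (I : Set R) := by
    have : (I : Set R) = (V : Set R) ∩ ⋂ z ∈ hF.toFinset, (h.rowIdeal hc z : Set R) := by simp [I]
    rw [this]
    exact hV.inter (isOpen_biInter_finset fun z _ => h.isOpen_rowIdeal hc z)
  obtain ⟨t, ht⟩ := QuotientAddGroup.mk_surjective (a (quotientOpen I hI))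
  have htU : QuotientAddGroup.mk t - a U ∈ U := by
    rw [ht]
    refine ha _ _ ?_
    rintro _ ⟨x, hx, rfl⟩
    exact hVP hx.1
  have hst : s - t ∈ P := by
    have hsum : HasSum (fun z => e z * (r z - t)) (s - t) := by
      simpa [mul_sub] using hs.sub (h.hasSum.mul_right t)
    refine mem_addSubgroup_of_hasSum hsum (AddSubgroup.isClosed_of_isOpen P hP) fun z => ?_
    by_cases hz : e z ∈ V
    · exact hVP (mul_mem_rightIdeal V hz _)
    · refine hJP _ ((h.mem_rowIdeal_iff hc).1 ?_)
      have h1 : a (quotientOpen I hI) - a (O z) ∈ O z := by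
        refine ha _ _ ?_
        rintro _ ⟨x, hx, rfl⟩
        refine ⟨x, ?_, rfl⟩
        have := hx.2
        simp only [Submodule.coe_iInf, Set.mem_iInter] at this
        exact this z (by simpa using hz)
      rw [← ht, ← hr z, ← QuotientAddGroup.mk_sub] at h1
      have := (h.rowIdeal hc z).neg_mem ((h.mk_mem_quotientOpen_rowIdeal hc).1 h1)
      simpa using this
  have := U.add_mem (show QuotientAddGroup.mk (s - t) ∈ U from hst) htU
  simpa using this

theorem isStronglyClosed (h : IsPerfectFamily e) (hc : IsCompleteGroup R) :
    IsStronglyClosed (topJacobson R).toAddSubgroup where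
  isClosed := h.isClosed_topJacobson hc
  complete_quotient := h.isCompleteGroup_quotient hc
  exists_lift := by
    classical
    intro X s hs
    choose r hr using fun x => QuotientAddGroup.mk_surjective (s x)
    -- Rows that vanish modulo the radical are replaced by `0`. For finitely many given rows this
    -- happens at almost all `x`, which makes the lifts converge to zero.
    let c : X → Z → R := fun x z => if r x ∈ h.rowIdeal hc z then 0 else r x
    choose a ha using fun x =>
      exists_hasSum_ring hc ((zeroConvergent_of_hasSum h.hasSum).mul (c x))
    refine ⟨a, fun W hW => ?_, fun x => ?_⟩
    · obtain ⟨U, hU, hUW⟩ := exists_open_rightIdeal hW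
      have hF := (zeroConvergent_of_hasSum h.hasSum).finite_notMem hU
      have hev : ∀ᶠ x in cofinite, ∀ z ∈ hF.toFinset, r x ∈ h.rowIdeal hc z := by
        rw [Filter.eventually_all_finset]
        intro z _
        have := hs.eventually ((quotientOpen _ (h.isOpen_rowIdeal hc z)).mem_nhds_zero)
        filter_upwards [this] with x hx
        rw [← hr x] at hx
        exact (h.mk_mem_quotientOpen_rowIdeal hc).1 hx
      refine mem_map.2 (mem_of_superset hev fun x hx => hUW ?_)
      refine mem_addSubgroup_of_hasSum (ha x) (isClosed_of_isOpen_rightIdeal hU) fun z => ?_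
      by_cases hz : e z ∈ U
      · exact mul_mem_rightIdeal U hz _
      · simp [c, hx z (by simpa using hz)]
    · rw [← hr x, eq_comm, QuotientAddGroup.eq, neg_add_eq_sub]
      have hsum : HasSum (fun z => e z * (c x z - r x)) (a x - r x) := by
        simpa [mul_sub] using (ha x).sub (h.hasSum.mul_right (r x))
      refine mem_addSubgroup_of_hasSum hsum (h.isClosed_topJacobson hc) fun z => ?_
      refine (h.mem_rowIdeal_iff hc).1 ?_
      simp only [c]
      split_ifs with hx
      · simpa using hx
      · simp

end StronglyClosed

end IsPerfectFamily

/-! ### Semisimplicity of the quotient by the radical -/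

section FiniteTopology

attribute [local instance] finiteTopology

theorem isOpen_setOf_apply_eq {A M : Type*} [Ring A] [AddCommGroup M] [Module A M] (v c : M) :
    IsOpen {f : Module.End A M | f v = c} := by
  let _ : TopologicalSpace M := ⊥
  have : DiscreteTopology M := ⟨rfl⟩
  have hcont : Continuous fun f : Module.End A M => f v :=
    (continuous_apply v).comp continuous_induced_dom
  exact (isOpen_discrete {c}).preimage hcont

theorem continuous_finiteTopology_of_isOpen {T A M : Type*} [TopologicalSpace T] [Ring A]
    [AddCommGroup M] [Module A M] {g : T → Module.End A M}
    (hg : ∀ v c, IsOpen {t | g t v = c}) : Continuous g := by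
  let _ : TopologicalSpace M := ⊥
  have : DiscreteTopology M := ⟨rfl⟩
  exact continuous_induced_rng.2 (continuous_pi fun v => continuous_discrete_rng.2 (hg v))

theorem continuous_conjRingEquiv {A M N : Type*} [Ring A] [AddCommGroup M] [Module A M]
    [AddCommGroup N] [Module A N] (φ : M ≃ₗ[A] N) : Continuous φ.conjRingEquiv := by
  refine continuous_finiteTopology_of_isOpen fun v c => ?_
  have : {f : Module.End A M | φ.conjRingEquiv f v = c} =
      {f : Module.End A M | f (φ.symm v) = φ.symm c} := by
    ext f
    exact (LinearEquiv.eq_symm_apply φ).symm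
  rw [this]
  exact isOpen_setOf_apply_eq _ _

theorem isTopSemisimple_of_ringEquiv {S : Type w} [Ring S] [TopologicalSpace S] {X : Type w}
    (D V : X → Type w) [∀ x, DivisionRing (D x)] [∀ x, AddCommGroup (V x)]
    [∀ x, Module (D x) (V x)] [∀ x, Nontrivial (V x)]
    (φ : S ≃+* ((x : X) → (Module.End (D x) (V x))ᵐᵒᵖ)) (hφ : IsHomeomorph φ) :
    IsTopSemisimple S := by
  let b : ∀ x, V x ≃ₗ[D x] (Module.Basis.ofVectorSpaceIndex (D x) (V x) →₀ D x) := fun x =>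
    (Module.Basis.ofVectorSpace (D x) (V x)).repr
  let ψ : ((x : X) → (Module.End (D x) (V x))ᵐᵒᵖ) ≃+*
      ((x : X) → (Module.End (D x) (Module.Basis.ofVectorSpaceIndex (D x) (V x) →₀ D x))ᵐᵒᵖ) :=
    RingEquiv.piCongrRight fun x => RingEquiv.op (b x).conjRingEquiv
  have hψ : IsHomeomorph ψ := by
    refine IsHomeomorph.mk ?_ ?_ ψ.bijective
    · exact continuous_pi fun x => MulOpposite.continuous_op.comp
        ((continuous_conjRingEquiv (b x)).comp
          (MulOpposite.continuous_unop.comp (continuous_apply x)))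
    · refine ψ.toEquiv.continuous_symm_iff.1 ?_
      exact continuous_pi fun x => MulOpposite.continuous_op.comp
        ((continuous_conjRingEquiv (b x).symm).comp
          (MulOpposite.continuous_unop.comp (continuous_apply x)))
  refine ⟨X, fun x => Module.Basis.ofVectorSpaceIndex (D x) (V x), D, inferInstance,
    fun x => (Module.Basis.ofVectorSpace (D x) (V x)).index_nonempty, φ.trans ψ, ?_⟩
  exact hψ.comp hφ

end FiniteTopology

/-! ### The ring acting on its simple modules. -/

section RightAction

variable {R : Type w} [Ring R]

/-- The action of a ring on a right module as endomorphisms over the endomorphism ring. -/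
def rightAction (V : Type*) [AddCommGroup V] [Module Rᵐᵒᵖ V] :
    R →+* (Module.End (Module.End Rᵐᵒᵖ V) V)ᵐᵒᵖ where
  toFun r := MulOpposite.op
    { toFun := fun v => MulOpposite.op r • v
      map_add' := smul_add _
      map_smul' := fun d v => (d.map_smul (MulOpposite.op r) v).symm }
  map_one' := MulOpposite.unop_injective (LinearMap.ext fun v => one_smul _ v)
  map_mul' r s := MulOpposite.unop_injective (LinearMap.ext fun v =>
    mul_smul (MulOpposite.op s) (MulOpposite.op r) v)
  map_zero' := MulOpposite.unop_injective (LinearMap.ext fun v => zero_smul _ v)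
  map_add' r s := MulOpposite.unop_injective (LinearMap.ext fun v =>
    add_smul (MulOpposite.op r) (MulOpposite.op s) v)

end RightAction

namespace IsPerfectFamily

attribute [local instance] finiteTopology

variable {R : Type w} [Ring R] [TopologicalSpace R] {Z : Type w} {e : Z → R}

/-- The relation on the indices given by isomorphisms of corners. -/
def isoSetoid (h : IsPerfectFamily e) : Setoid Z where
  r z w := ∃ a, IsCornerIso (e z) (e w) a
  iseqv :=
    { refl := fun z => ⟨e z, isCornerIso_self (h.idem z)⟩
      symm := fun ⟨_, ha⟩ => let ⟨b, hb, _⟩ := ha.symm; ⟨b, hb⟩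
      trans := fun ⟨_, ha⟩ ⟨_, hb⟩ => ⟨_, ha.trans (h.idem _) (h.idem _) hb⟩ }

theorem exists_iso_out (h : IsPerfectFamily e) (w : Z) :
    ∃ u v, IsCornerIso (e (Quotient.mk h.isoSetoid w).out) (e w) u ∧
      IsCornerIso (e w) (e (Quotient.mk h.isoSetoid w).out) v ∧
      u * v = e (Quotient.mk h.isoSetoid w).out ∧ v * u = e w := by
  obtain ⟨u, hu⟩ : ∃ u, IsCornerIso (e (Quotient.mk h.isoSetoid w).out) (e w) u :=
    Quotient.mk_out (s := h.isoSetoid) w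
  obtain ⟨v, hv, h1, h2⟩ := hu.symm
  exact ⟨u, v, hu, hv, h1, h2⟩

variable [IsTopologicalRing R] [IsLinearTopology Rᵐᵒᵖ R] [T2Space R]
  (h : IsPerfectFamily e) (hc : IsCompleteGroup R)

/-- The simple discrete right module attached to an isomorphism class of corners. -/
abbrev SimpleModule (x : Quotient h.isoSetoid) : Type w := R ⧸ h.rowIdeal hc x.out

instance (x : Quotient h.isoSetoid) : IsSimpleModule Rᵐᵒᵖ (h.SimpleModule hc x) :=
  isSimpleModule_iff_isCoatom.2 (h.isCoatom_rowIdeal hc x.out)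

instance (x : Quotient h.isoSetoid) : Nontrivial (h.SimpleModule hc x) :=
  IsSimpleModule.nontrivial Rᵐᵒᵖ _

instance (x : Quotient h.isoSetoid) :
    DivisionRing (Module.End Rᵐᵒᵖ (h.SimpleModule hc x)) :=
  letI := Classical.decEq (Module.End Rᵐᵒᵖ (h.SimpleModule hc x))
  Module.End.instDivisionRing

/-- The action of the ring on all the simple modules. -/
def simpleAction : R →+* ((x : Quotient h.isoSetoid) →
    (Module.End (Module.End Rᵐᵒᵖ (h.SimpleModule hc x)) (h.SimpleModule hc x))ᵐᵒᵖ) :=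
  RingHom.pi fun x => rightAction (h.SimpleModule hc x)

theorem simpleAction_apply_mk (r : R) (x : Quotient h.isoSetoid) (a : R) :
    (h.simpleAction hc r x).unop (Submodule.Quotient.mk a) =
      (Submodule.Quotient.mk (a * r) : h.SimpleModule hc x) := rfl

/-- Transfers information from the representative `z` of a class to the row of any isomorphic index
`w`. -/
theorem mul_mem_topJacobson_of_iso {z w : Z} {u v r : R} (hu : IsCornerIso (e z) (e w) u)
    (hvu : v * u = e w) (hr : u * r ∈ h.rowIdeal hc z) : e w * r ∈ topJacobson R := by
  rw [h.mem_rowIdeal_iff hc, ← mul_assoc, hu.left_mul (h.idem z)] at hr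
  rw [← hvu, mul_assoc]
  exact (topJacobson R).mul_mem_left v hr

theorem simpleAction_eq_zero_iff {r : R} : h.simpleAction hc r = 0 ↔ r ∈ topJacobson R := by
  refine ⟨fun hr => (h.mem_topJacobson hc).2 fun w => (h.mem_rowIdeal_iff hc).2 ?_, fun hr => ?_⟩
  · obtain ⟨u, v, hu, hv, huv, hvu⟩ := h.exists_iso_out w
    refine h.mul_mem_topJacobson_of_iso hc hu hvu ?_
    have h1 := h.simpleAction_apply_mk hc r (Quotient.mk h.isoSetoid w) u
    rw [hr] at h1
    exact (Submodule.Quotient.mk_eq_zero _).1 h1.symm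
  · funext x
    refine MulOpposite.unop_injective (LinearMap.ext fun a => ?_)
    obtain ⟨a, rfl⟩ := Submodule.Quotient.mk_surjective _ a
    rw [simpleAction_apply_mk]
    exact (Submodule.Quotient.mk_eq_zero _).2
      (h.topJacobson_le_rowIdeal hc ((topJacobson R).mul_mem_left a hr))

theorem continuous_simpleAction : Continuous (h.simpleAction hc) := by
  refine continuous_pi fun x => MulOpposite.continuous_op.comp
    (continuous_finiteTopology_of_isOpen
      (g := fun r => (h.simpleAction hc r x).unop) fun a c => ?_)
  obtain ⟨a, rfl⟩ := Submodule.Quotient.mk_surjective _ a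
  refine isOpen_iff_forall_mem_open.2 fun r₀ hr₀ => ⟨{r | a * (r - r₀) ∈ h.rowIdeal hc x.out},
    fun r hr => ?_, (h.isOpen_rowIdeal hc x.out).preimage (by fun_prop), by simp⟩
  refine Eq.trans ?_ hr₀
  rw [simpleAction_apply_mk, simpleAction_apply_mk, Submodule.Quotient.eq, ← mul_sub]
  exact hr

/-- Left multiplication by an element of the corner as an endomorphism of the simple module. -/
theorem exists_end_mk_mul {x : Quotient h.isoSetoid} {c : R} (hcx : c * e x.out = c) :
    ∃ d : Module.End Rᵐᵒᵖ (h.SimpleModule hc x), ∀ b : R,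
      d (Submodule.Quotient.mk b) = Submodule.Quotient.mk (c * b) := by
  refine ⟨Submodule.mapQ _ _ (LinearMap.mulLeft Rᵐᵒᵖ c) fun b hb => ?_, fun b => rfl⟩
  rw [h.mem_rowIdeal_iff hc] at hb
  rw [Submodule.mem_comap, LinearMap.mulLeft_apply, ← hcx, mul_assoc]
  exact h.topJacobson_le_rowIdeal hc ((topJacobson R).mul_mem_left c hb)

/-- An endomorphism is determined by its values on the classes of the `u w`, because over the Schur
division ring these span the classes of all `a * e w`. The values can be prescribed independently,
one row at a time. -/
theorem surjective_simpleAction : Function.Surjective (h.simpleAction hc) := by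
  classical
  intro φ
  choose u v hu hv huv hvu using h.exists_iso_out
  choose l hl using fun w => Submodule.Quotient.mk_surjective _
    ((φ (Quotient.mk h.isoSetoid w)).unop (Submodule.Quotient.mk (u w)))
  -- Row `w` of `r` is chosen so that `u w * r` represents the prescribed value `l w`.
  obtain ⟨r, hr⟩ := exists_hasSum_ring hc
    ((zeroConvergent_of_hasSum h.hasSum).mul fun w => v w * l w)
  have hur : ∀ w, u w * r = e (Quotient.mk h.isoSetoid w).out * l w := fun w => by
    refine (hr.mul_left (u w)).unique ?_
    have h1 : ∀ w', w' ≠ w → u w * (e w' * (v w' * l w')) = 0 := fun w' hw' => by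
      rw [← mul_assoc, ← (hu w).mul_right (h.idem w), mul_assoc (u w),
        h.orthogonal.ortho (Ne.symm hw'), mul_zero, zero_mul]
    have h2 := hasSum_single w h1
    rwa [← mul_assoc, (hu w).mul_right (h.idem w), ← mul_assoc, huv] at h2
  refine ⟨r, ?_⟩
  funext x
  refine MulOpposite.unop_injective (LinearMap.ext fun a => ?_)
  obtain ⟨a, rfl⟩ := Submodule.Quotient.mk_surjective _ a
  let π : R →+ h.SimpleModule hc x := (Submodule.mkQ (h.rowIdeal hc x.out)).toAddMonoidHom
  -- The locus of agreement contains an open right ideal, hence is closed, and may be tested on the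
  -- summands `a * e w`.
  let A : AddSubgroup R :=
    ((φ x).unop.toAddMonoidHom.comp π).eqLocus ((h.simpleAction hc r x).unop.toAddMonoidHom.comp π)
  have hA : ∀ a, a ∈ A ↔ (φ x).unop (Submodule.Quotient.mk a) =
    (h.simpleAction hc r x).unop (Submodule.Quotient.mk a) := fun a => Iff.rfl
  have hIA : (h.rowIdeal hc x.out).toAddSubgroup ≤ A := fun a ha => by
    rw [hA, (Submodule.Quotient.mk_eq_zero (h.rowIdeal hc x.out)).2 ha, map_zero, map_zero]
  have hAcl : IsClosed (A : Set R) :=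
    AddSubgroup.isClosed_of_isOpen A (AddSubgroup.isOpen_mono hIA (h.isOpen_rowIdeal hc x.out))
  refine Eq.symm ((hA a).1 ?_)
  have hsum : HasSum (fun w => a * e w) a := by simpa using h.hasSum.mul_left a
  refine mem_addSubgroup_of_hasSum hsum hAcl fun w => ?_
  by_cases hw : Quotient.mk h.isoSetoid w = x
  · subst hw
    set z := (Quotient.mk h.isoSetoid w).out
    have hcz : e z * a * v w * e z = e z * a * v w := by
      rw [mul_assoc, (hv w).mul_right (h.idem z)]
    obtain ⟨d, hd⟩ := h.exists_end_mk_mul hc (x := Quotient.mk h.isoSetoid w) hcz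
    have hmk : (Submodule.Quotient.mk (a * e w) : h.SimpleModule hc (Quotient.mk h.isoSetoid w)) =
        d • Submodule.Quotient.mk (u w) := by
      refine Eq.trans ?_ (hd (u w)).symm
      rw [Submodule.Quotient.eq]
      refine h.mem_rowIdeal_of_mul_eq_zero hc ?_
      rw [mul_assoc, hvu, mul_sub, ← mul_assoc, ← mul_assoc, ← mul_assoc, h.idem, sub_self]
    rw [hA, hmk, map_smul, map_smul, ← hl, simpleAction_apply_mk, hur]
    refine (hd (l w)).trans (Eq.trans ?_ (hd _).symm)
    rw [← mul_assoc, show e z * a * v w * e (Quotient.mk h.isoSetoid w).out = _ from hcz]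
  · refine hIA ((h.mem_rowIdeal hc).2 fun w' hiso => ?_)
    by_cases hw' : w = w'
    · subst hw'
      refine hw ?_
      rw [← Quotient.out_eq x]
      exact Quotient.sound (s := h.isoSetoid) (h.isoSetoid.symm ⟨_, hiso⟩)
    · rw [mul_assoc, mul_assoc a, h.orthogonal.ortho hw', mul_zero, mul_zero] at hiso
      exact (h.cornerRadical hc x.out w').zero_mem (by simpa using hiso)

/-- The quotient by the radical as a product of endomorphism rings of vector spaces. -/
def quotientEquiv : R ⧸ topJacobson R ≃+* ((x : Quotient h.isoSetoid) →
    (Module.End (Module.End Rᵐᵒᵖ (h.SimpleModule hc x)) (h.SimpleModule hc x))ᵐᵒᵖ) :=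
  RingEquiv.ofBijective
    (Ideal.Quotient.lift (topJacobson R) (h.simpleAction hc)
      fun _ hr => (h.simpleAction_eq_zero_iff hc).2 hr)
    ⟨(injective_iff_map_eq_zero _).2 fun a ha => by
      obtain ⟨a, rfl⟩ := Ideal.Quotient.mk_surjective a
      exact Ideal.Quotient.eq_zero_iff_mem.2 ((h.simpleAction_eq_zero_iff hc).1 ha),
    Ideal.Quotient.lift_surjective_of_surjective _ _ (h.surjective_simpleAction hc)⟩

theorem quotientEquiv_mk (r : R) :
    h.quotientEquiv hc (Ideal.Quotient.mk _ r) = h.simpleAction hc r := rfl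

theorem isHomeomorph_quotientEquiv : IsHomeomorph (h.quotientEquiv hc) := by
  classical
  refine IsHomeomorph.mk ?_ ?_ (h.quotientEquiv hc).bijective
  · exact continuous_quot_lift _ (h.continuous_simpleAction hc)
  · intro O hO
    have hO' : IsOpen (Ideal.Quotient.mk (topJacobson R) ⁻¹' O) := hO.preimage continuous_quot_mk
    rw [isOpen_iff_forall_mem_open]
    rintro _ ⟨r₀, hr₀, rfl⟩
    obtain ⟨r₀, rfl⟩ := Ideal.Quotient.mk_surjective r₀
    have hnhds : (fun r => r₀ + r) ⁻¹' (Ideal.Quotient.mk (topJacobson R) ⁻¹' O) ∈ 𝓝 (0 : R) :=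
      (hO'.preimage (continuous_const_add r₀)).mem_nhds (by simpa using hr₀)
    obtain ⟨U, hU, hUO⟩ := exists_open_rightIdeal hnhds
    have hF := (zeroConvergent_of_hasSum h.hasSum).finite_notMem hU
    choose u v hu hv huv hvu using h.exists_iso_out
    -- Agreement with `r₀` on finitely many vectors `u w` puts the rows with `e w ∉ U` of `r - r₀`
    -- into the radical; the other rows are in `U`.
    refine ⟨⋂ w ∈ hF.toFinset, {ψ | (ψ (Quotient.mk h.isoSetoid w)).unop
      (Submodule.Quotient.mk (u w)) = Submodule.Quotient.mk (u w * r₀)}, fun ψ hψ => ?_,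
      isOpen_biInter_finset fun w _ => ?_, ?_⟩
    · obtain ⟨r, rfl⟩ := h.surjective_simpleAction hc ψ
      refine ⟨Ideal.Quotient.mk _ r, ?_, h.quotientEquiv_mk hc r⟩
      let K : AddSubgroup R := U.toAddSubgroup ⊔ (topJacobson R).toAddSubgroup
      have hK : IsClosed (K : Set R) :=
        AddSubgroup.isClosed_of_isOpen K (AddSubgroup.isOpen_mono le_sup_left hU)
      have hsum : HasSum (fun w => e w * (r - r₀)) (r - r₀) := by
        simpa using h.hasSum.mul_right (r - r₀)
      have hrK : r - r₀ ∈ K := by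
        refine mem_addSubgroup_of_hasSum hsum hK fun w => ?_
        by_cases hw : e w ∈ U
        · exact AddSubgroup.mem_sup_left (mul_mem_rightIdeal U hw _)
        · refine AddSubgroup.mem_sup_right (h.mul_mem_topJacobson_of_iso hc (hu w) (hvu w) ?_)
          have h1 := Set.mem_iInter₂.1 hψ w (by simpa using hw)
          rw [Set.mem_ofPred_eq, simpleAction_apply_mk, Submodule.Quotient.eq, ← mul_sub] at h1
          exact h1
      obtain ⟨s, hs, j, hj, hsj⟩ := AddSubgroup.mem_sup.1 hrK
      have h2 : Ideal.Quotient.mk (topJacobson R) r =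
          Ideal.Quotient.mk (topJacobson R) (r₀ + s) := by
        rw [Ideal.Quotient.eq]
        have : r - (r₀ + s) = j := by rw [← sub_sub, ← hsj]; abel
        rw [this]
        exact hj
      rw [h2]
      exact hUO hs
    · exact (isOpen_setOf_apply_eq _ _).preimage
        (MulOpposite.continuous_unop.comp (continuous_apply _))
    · exact Set.mem_iInter₂.2 fun w _ => h.simpleAction_apply_mk hc r₀ _ (u w)

theorem isTopLeftPerfect (h : IsPerfectFamily e) (hc : IsCompleteGroup R) : IsTopLeftPerfect R where
  tNilpotent := h.isTopLeftTNilpotent_topJacobson hc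
  stronglyClosed := h.isStronglyClosed hc
  semisimple := isTopSemisimple_of_ringEquiv _ (h.SimpleModule hc) (h.quotientEquiv hc)
    (h.isHomeomorph_quotientEquiv hc)

end IsPerfectFamily

/-! ### Sums of morphisms in topologically agreeable categories -/

section Composition

variable {C : Type u} [Category.{v} C] [Preadditive C] [RightTopological C]

theorem continuous_precomp {L M : C} (f : L ⟶ M) (N : C) :
    Continuous fun g : M ⟶ N => f ≫ g :=
  (RightTopological.continuous_comp L M N).comp (Continuous.prodMk_right f)

theorem continuous_postcomp (L : C) {M N : C} (g : M ⟶ N) :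
    Continuous fun f : L ⟶ M => f ≫ g :=
  (RightTopological.continuous_comp L M N).comp (Continuous.prodMk_left g)

instance (M N : C) : NonarchimedeanAddGroup (M ⟶ N) where
  is_nonarchimedean W hW :=
    let ⟨V, hV, _, hVW⟩ := RightTopological.exists_open_submodule M N W hW
    ⟨⟨V, hV⟩, hVW⟩

theorem hasSum_precomp {L M N : C} {X : Type*} {f : X → (M ⟶ N)} {s : M ⟶ N} (hf : HasSum f s)
    (g : L ⟶ M) : HasSum (fun x => g ≫ f x) (g ≫ s) :=
  hf.map (Preadditive.leftComp N g) (continuous_precomp g N)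

theorem hasSum_postcomp {L M N : C} {X : Type*} {f : X → (L ⟶ M)} {s : L ⟶ M} (hf : HasSum f s)
    (g : M ⟶ N) : HasSum (fun x => f x ≫ g) (s ≫ g) :=
  hf.map (Preadditive.rightComp L g) (continuous_postcomp L g)

end Composition

section Coproducts

variable {C : Type u} [Category.{v} C] [Preadditive C] [HasCoproducts.{v} C]

theorem ι_coprodProj_self {X : Type v} (N : X → C) (x : X) :
    Sigma.ι N x ≫ coprodProj N x = 𝟙 (N x) := by
  classical
  exact Sigma.ι_π_eq_id N x

theorem ι_coprodProj_of_ne {X : Type v} (N : X → C) {x y : X} (h : x ≠ y) :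
    Sigma.ι N x ≫ coprodProj N y = 0 := by
  classical
  exact Sigma.ι_π_of_ne N h

theorem sigmaMap_coprodProj {X : Type v} {N P : X → C} (g : (x : X) → (N x ⟶ P x)) (x : X) :
    Limits.Sigma.map g ≫ coprodProj P x = coprodProj N x ≫ g x := by
  refine Sigma.hom_ext _ _ fun y => ?_
  rw [Sigma.ι_map_assoc]
  by_cases h : y = x
  · subst h
    rw [ι_coprodProj_self, ← Category.assoc, ι_coprodProj_self, Category.comp_id, Category.id_comp]
  · rw [ι_coprodProj_of_ne _ h, ← Category.assoc, ι_coprodProj_of_ne _ h, comp_zero, zero_comp]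

theorem IsSummable.comp {M : C} {X : Type v} {N P : X → C} {f : (x : X) → (M ⟶ N x)}
    (hf : IsSummable f) (g : (x : X) → (N x ⟶ P x)) : IsSummable fun x => f x ≫ g x := by
  obtain ⟨F, hF⟩ := hf
  refine ⟨F ≫ Limits.Sigma.map g, fun x => ?_⟩
  rw [Category.assoc, sigmaMap_coprodProj, ← Category.assoc, hF]

theorem IsSummable.precomp {L M : C} {X : Type v} {N : X → C} {f : (x : X) → (M ⟶ N x)}
    (hf : IsSummable f) (g : L ⟶ M) : IsSummable fun x => g ≫ f x := by
  obtain ⟨F, hF⟩ := hf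
  exact ⟨g ≫ F, fun x => by rw [Category.assoc, hF]⟩

theorem isSummable_coprodProj {X : Type v} (N : X → C) : IsSummable (coprodProj N) :=
  ⟨𝟙 _, fun _ => Category.id_comp _⟩

variable [RightTopological C] [TopologicallyAgreeable C]

instance (M N : C) : T2Space (M ⟶ N) := TopologicallyAgreeable.separated M N

/-- The projections are summable, so the series converges by agreeability; its sum is identified on
the injections. -/
theorem hasSum_coprodProj_ι {X : Type v} (N : X → C) :
    HasSum (fun x => coprodProj N x ≫ Sigma.ι N x) (𝟙 (∐ N)) := by
  obtain ⟨s, hs⟩ := exists_hasSum (TopologicallyAgreeable.complete _ _)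
    (TopologicallyAgreeable.zeroConvergent_of_summable _ _ _ _
      ((isSummable_coprodProj N).comp fun x => Sigma.ι N x))
  have hs1 : s = 𝟙 (∐ N) := by
    refine Sigma.hom_ext _ _ fun x => ?_
    have h1 : HasSum (fun y => Sigma.ι N x ≫ coprodProj N y ≫ Sigma.ι N y)
        (Sigma.ι N x ≫ coprodProj N x ≫ Sigma.ι N x) :=
      hasSum_single x fun y hy => by
        rw [← Category.assoc, ι_coprodProj_of_ne N (Ne.symm hy), zero_comp]
    rw [(hasSum_precomp hs (Sigma.ι N x)).unique h1, ← Category.assoc, ι_coprodProj_self,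
      Category.id_comp, Category.comp_id]
  rwa [hs1] at hs

/-- A zero-convergent family of morphisms between two objects is summable. -/
theorem isSummable_of_zeroConvergent {M N : C} {X : Type v} {f : X → (M ⟶ N)}
    (hf : ZeroConvergent f) : IsSummable f := by
  have hz : ZeroConvergent fun x => f x ≫ Sigma.ι (fun _ : X => N) x := by
    cases isEmpty_or_nonempty X
    · simp only [ZeroConvergent, cofinite_eq_bot]
      exact tendsto_bot
    · obtain ⟨x₀⟩ := ‹Nonempty X›
      intro W hW
      obtain ⟨V, hV, hVmul, hVW⟩ := RightTopological.exists_open_submodule _ _ W hW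
      have h1 : {g : M ⟶ N | g ≫ Sigma.ι (fun _ : X => N) x₀ ∈ V} ∈ 𝓝 (0 : M ⟶ N) :=
        (hV.preimage (continuous_postcomp M (Sigma.ι (fun _ : X => N) x₀))).mem_nhds (by simp)
      refine mem_map.2 (mem_of_superset (mem_map.1 (hf h1)) fun x hx => hVW ?_)
      -- Every injection is the `x₀`-th one followed by an endomorphism of the copower, and `V` is
      -- stable under endomorphisms; one neighbourhood thus serves all `x`.
      have h2 := hVmul _ hx (Sigma.desc fun _ => Sigma.ι (fun _ : X => N) x)
      rwa [Category.assoc, Sigma.ι_desc] at h2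
  obtain ⟨F, hF⟩ := exists_hasSum (TopologicallyAgreeable.complete _ _) hz
  refine ⟨F, fun x => (hasSum_postcomp hF (coprodProj _ x)).unique ?_⟩
  have h1 : HasSum (fun y => (f y ≫ Sigma.ι (fun _ : X => N) y) ≫ coprodProj _ x)
      ((f x ≫ Sigma.ι (fun _ : X => N) x) ≫ coprodProj _ x) :=
    hasSum_single x fun y hy => by
      rw [Category.assoc, ι_coprodProj_of_ne (fun _ : X => N) hy, comp_zero]
  rwa [Category.assoc, ι_coprodProj_self, Category.comp_id] at h1

end Coproducts

/-! ### The opposite endomorphism ring -/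

section EndRing

variable {C : Type u} [Category.{v} C] [Preadditive C] [RightTopological C]

theorem IsCompleteGroup.op {A : Type w} [Ring A] [TopologicalSpace A]
    (hA : IsCompleteGroup A) : IsCompleteGroup Aᵐᵒᵖ := by
  intro a ha
  let F : OpenAddSubgroup A → OpenAddSubgroup Aᵐᵒᵖ := fun U =>
    U.comap (MulOpposite.opAddEquiv.symm : Aᵐᵒᵖ ≃+ A).toAddMonoidHom MulOpposite.continuous_unop
  obtain ⟨x, hx⟩ := hA (fun U => (a (F U)).unop) fun U V hUV => ha (F U) (F V) fun _ h => hUV h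
  refine ⟨MulOpposite.op x, fun V => ?_⟩
  exact hx (V.comap (MulOpposite.opAddEquiv : A ≃+ Aᵐᵒᵖ).toAddMonoidHom MulOpposite.continuous_op)

instance (M : C) : IsLinearTopology (End M)ᵐᵒᵖᵐᵒᵖ (End M)ᵐᵒᵖ := by
  refine ⟨⟨fun W => ⟨fun hW => ?_, fun ⟨V, hV, hVW⟩ => mem_of_superset hV hVW⟩⟩⟩
  have h1 : MulOpposite.op ⁻¹' W ∈ 𝓝 (0 : M ⟶ M) :=
    (MulOpposite.continuous_op (M := End M)).continuousAt.preimage_mem_nhds hW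
  obtain ⟨V, hV, hVmul, hVW⟩ := RightTopological.exists_open_submodule M M _ h1
  let I : Submodule (End M)ᵐᵒᵖᵐᵒᵖ (End M)ᵐᵒᵖ :=
    { carrier := {a | a.unop ∈ V}
      add_mem' := fun ha hb => V.add_mem ha hb
      zero_mem' := V.zero_mem
      smul_mem' := fun s a ha => hVmul _ ha s.unop.unop }
  have hI : IsOpen (I : Set (End M)ᵐᵒᵖ) := hV.preimage (MulOpposite.continuous_unop (M := End M))
  exact ⟨I, hI.mem_nhds I.zero_mem, fun a ha => hVW ha⟩

variable [HasCoproducts.{v} C] [TopologicallyAgreeable C]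

instance (M : C) : T2Space (End M) := TopologicallyAgreeable.separated M M

theorem isCompleteGroup_endOp (M : C) : IsCompleteGroup (End M)ᵐᵒᵖ :=
  IsCompleteGroup.op (A := End M) (TopologicallyAgreeable.complete M M)

end EndRing

/-! ### Perfect decompositions and perfect families of idempotents -/

section Splittings

variable {C : Type u} [Category.{v} C] [Preadditive C]

/-- A family of direct summands of `M` with pairwise orthogonal projectors. -/
structure SplitFamily (M : C) {Z : Type v} (N : Z → C) where
  i : (z : Z) → (N z ⟶ M)
  r : (z : Z) → (M ⟶ N z)
  i_r_self : ∀ z, i z ≫ r z = 𝟙 (N z)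
  i_r_of_ne : ∀ {z w}, z ≠ w → i z ≫ r w = 0

namespace SplitFamily

variable {M : C} {Z : Type v} {N : Z → C} (S : SplitFamily M N)

/-- The endomorphism of `M` induced by a morphism between two summands. -/
def extend {z w : Z} (f : N z ⟶ N w) : (End M)ᵐᵒᵖ := MulOpposite.op (S.r z ≫ f ≫ S.i w)

/-- The component of an endomorphism of `M` between two summands. -/
def restrict (z w : Z) (a : (End M)ᵐᵒᵖ) : N z ⟶ N w := S.i z ≫ a.unop ≫ S.r w

theorem extend_mul {z w u : Z} (f : N z ⟶ N w) (g : N w ⟶ N u) :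
    S.extend f * S.extend g = S.extend (f ≫ g) := by
  refine MulOpposite.unop_injective ?_
  change (S.r z ≫ f ≫ S.i w) ≫ S.r w ≫ g ≫ S.i u = S.r z ≫ (f ≫ g) ≫ S.i u
  simp only [Category.assoc]
  rw [← Category.assoc (S.i w), S.i_r_self, Category.id_comp]

theorem extend_mul_of_ne {z w w' u : Z} (h : w ≠ w') (f : N z ⟶ N w) (g : N w' ⟶ N u) :
    S.extend f * S.extend g = 0 := by
  refine MulOpposite.unop_injective ?_
  change (S.r z ≫ f ≫ S.i w) ≫ S.r w' ≫ g ≫ S.i u = 0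
  simp only [Category.assoc]
  rw [← Category.assoc (S.i w), S.i_r_of_ne h]
  simp

theorem restrict_extend {z w : Z} (f : N z ⟶ N w) : S.restrict z w (S.extend f) = f := by
  change S.i z ≫ (S.r z ≫ f ≫ S.i w) ≫ S.r w = f
  simp only [Category.assoc]
  rw [S.i_r_self, Category.comp_id, ← Category.assoc, S.i_r_self, Category.id_comp]

/-- The projector onto a summand. -/
def idem (z : Z) : (End M)ᵐᵒᵖ := S.extend (𝟙 (N z))

theorem extend_restrict (z w : Z) (a : (End M)ᵐᵒᵖ) :
    S.extend (S.restrict z w a) = S.idem z * a * S.idem w := by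
  refine MulOpposite.unop_injective ?_
  change S.r z ≫ (S.i z ≫ a.unop ≫ S.r w) ≫ S.i w =
    ((S.r z ≫ 𝟙 _ ≫ S.i z) ≫ a.unop) ≫ S.r w ≫ 𝟙 _ ≫ S.i w
  simp only [Category.assoc, Category.id_comp]

theorem idem_mul_extend_mul {z w : Z} (f : N z ⟶ N w) :
    S.idem z * S.extend f * S.idem w = S.extend f := by
  rw [← extend_restrict, restrict_extend]

theorem extend_injective {z w : Z} : Function.Injective (S.extend (z := z) (w := w)) :=
  Function.LeftInverse.injective (g := S.restrict z w) S.restrict_extend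

theorem orthogonalIdempotents : OrthogonalIdempotents S.idem where
  idem z := by rw [IsIdempotentElem, idem, extend_mul, Category.comp_id]
  ortho _ _ h := S.extend_mul_of_ne h _ _

theorem isCornerIso_extend_iff {z w : Z} (f : N z ⟶ N w) :
    IsCornerIso (S.idem z) (S.idem w) (S.extend f) ↔ IsIso f := by
  constructor
  · rintro ⟨-, b, hb, h1, h2⟩
    rw [← hb, ← extend_restrict, extend_mul] at h1 h2
    exact ⟨S.restrict w z b, S.extend_injective h1, S.extend_injective h2⟩
  · intro hf
    refine ⟨S.idem_mul_extend_mul f, S.extend (inv f), S.idem_mul_extend_mul _, ?_, ?_⟩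
    · rw [extend_mul, IsIso.hom_inv_id, idem]
    · rw [extend_mul, IsIso.inv_hom_id, idem]

theorem idem_eq_zero_iff (z : Z) : S.idem z = 0 ↔ IsZero (N z) := by
  rw [IsZero.iff_id_eq_zero]
  refine ⟨fun h => S.extend_injective (h.trans ?_), fun h => ?_⟩ <;>
  · refine MulOpposite.unop_injective ?_
    simp [extend, idem, *]

theorem prod_extend (z : ℕ → Z) (f : (i : ℕ) → (N (z i) ⟶ N (z (i + 1)))) (n : ℕ) :
    ((List.range (n + 1)).map fun i => S.extend (f i)).prod =
      S.extend (compSeq (N := fun i => N (z i)) f n) := by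
  induction n with
  | zero => simp [compSeq]
  | succ n ih =>
    rw [List.range_succ, List.map_append, List.prod_append, ih]
    simp only [List.map_cons, List.map_nil, List.prod_singleton]
    rw [extend_mul]
    rfl

variable [HasCoproducts.{v} C] [RightTopological C] [TopologicallyAgreeable C]

theorem isPerfectFamily_iff (hS : HasSum S.idem 1) :
    IsPerfectFamily S.idem ↔ IsLocallyTNilpotent N := by
  constructor
  · intro h
    refine ⟨fun z hz => h.ne_zero z ((S.idem_eq_zero_iff z).2 hz), fun z f hf => ?_⟩
    have h1 := h.tNilpotent z (fun i => S.extend (f i)) (fun i => S.idem_mul_extend_mul _)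
      fun i hi => hf i ((S.isCornerIso_extend_iff _).1 hi)
    simp only [prod_extend] at h1
    -- The targets vary with `n`, so the compositions are pushed into `M`, where convergence makes
    -- sense; composing with the retractions afterwards recovers the original family.
    have h2 : ZeroConvergent fun n : ULift.{v} ℕ =>
        compSeq (N := fun i => N (z i)) f n.down ≫ S.i (z (n.down + 1)) := by
      have h3 := ((continuous_precomp (S.i (z 0)) M).comp
        (MulOpposite.continuous_unop (M := End M))).continuousAt.tendsto.comp h1
      rw [← Nat.cofinite_eq_atTop] at h3
      have h4 := h3.comp (f := fun n : ULift.{v} ℕ => n.down)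
        ULift.down_injective.tendsto_cofinite
      have h5 : S.i (z 0) ≫ (0 : M ⟶ M) = 0 := comp_zero
      change Tendsto _ _ (𝓝 (S.i (z 0) ≫ (0 : M ⟶ M))) at h4
      rw [h5] at h4
      refine h4.congr fun n => ?_
      change S.i (z 0) ≫ S.r (z 0) ≫ _ ≫ _ = _
      rw [← Category.assoc, S.i_r_self, Category.id_comp]
    have h3 := (isSummable_of_zeroConvergent h2).comp fun n => S.r (z (n.down + 1))
    simp only [Category.assoc, S.i_r_self, Category.comp_id] at h3
    exact h3
  · intro h
    refine ⟨S.orthogonalIdempotents, fun z hz => h.nonzero z ((S.idem_eq_zero_iff z).1 hz), hS,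
      fun z a ha hna => ?_⟩
    have hf : ∀ i, S.extend (S.restrict (z i) (z (i + 1)) (a i)) = a i := fun i => by
      rw [extend_restrict, ha]
    have h1 := h.summable z (fun i => S.restrict (z i) (z (i + 1)) (a i)) fun i hi =>
      hna i (by rw [← hf i]; exact (S.isCornerIso_extend_iff _).2 hi)
    have h2 := TopologicallyAgreeable.zeroConvergent_of_summable _ _ _ _
      ((h1.comp fun n => S.i (z (n.down + 1))).precomp (S.r (z 0)))
    have h3 := h2.comp (f := fun n : ℕ => ULift.up.{v} n)
      ULift.up_injective.tendsto_cofinite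
    rw [Nat.cofinite_eq_atTop] at h3
    have h4 := ((MulOpposite.continuous_op (M := End M)).tendsto 0).comp h3
    refine h4.congr fun n => ?_
    have h5 := S.prod_extend z (fun i => S.restrict (z i) (z (i + 1)) (a i)) n
    simp only [hf] at h5
    exact h5.symm

/-- The object is the coproduct of a family of summands whose projectors sum to the identity. -/
theorem nonempty_iso (hS : HasSum S.idem 1) : Nonempty (M ≅ ∐ N) := by
  have hsum : HasSum (fun z => S.r z ≫ S.i z) (𝟙 M) := by
    have h1 := HasSum.unop hS
    simp only [idem, extend, Category.id_comp, MulOpposite.unop_op] at h1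
    exact h1
  -- The morphism `F` with components `S.r z` exists since the projectors, and hence their
  -- composites with the retractions, are summable.
  obtain ⟨F, hF⟩ := (isSummable_of_zeroConvergent (zeroConvergent_of_hasSum hsum)).comp S.r
  have hFr : ∀ z, F ≫ coprodProj N z = S.r z := fun z => by
    refine (hF z).trans ?_
    change (S.r z ≫ S.i z) ≫ S.r z = S.r z
    rw [Category.assoc, S.i_r_self, Category.comp_id]
  refine ⟨F, Sigma.desc S.i, ?_, ?_⟩
  · have h1 := hasSum_precomp (hasSum_postcomp (hasSum_coprodProj_ι N) (Sigma.desc S.i)) F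
    simp only [Category.id_comp, Category.assoc, Sigma.ι_desc] at h1
    simp only [← Category.assoc, hFr] at h1
    simpa using h1.unique hsum
  · refine Sigma.hom_ext _ _ fun z => ?_
    rw [← Category.assoc, Sigma.ι_desc, Category.comp_id]
    refine Agreeable.eta_injective _ _ _ (funext fun w => ?_)
    change (S.i z ≫ F) ≫ coprodProj N w = Sigma.ι N z ≫ coprodProj N w
    rw [Category.assoc, hFr]
    by_cases h : z = w
    · subst h
      rw [S.i_r_self, ι_coprodProj_self]
    · rw [S.i_r_of_ne h, ι_coprodProj_of_ne N h]

end SplitFamily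

theorem exists_splitFamily [IsIdempotentComplete C] {M : C} {Z : Type v} {e : Z → (End M)ᵐᵒᵖ}
    (he : OrthogonalIdempotents e) : ∃ (N : Z → C) (S : SplitFamily M N), S.idem = e := by
  choose N i r hir hri using fun z =>
    IsIdempotentComplete.idempotents_split M (e z).unop
      (congrArg MulOpposite.unop (he.idem z).eq)
  refine ⟨N, ⟨i, r, hir, fun {z w} h => ?_⟩, funext fun z => MulOpposite.unop_injective ?_⟩
  · have h1 : (e z).unop ≫ (e w).unop = 0 := congrArg MulOpposite.unop (he.ortho h)
    have h2 : i z ≫ r w = i z ≫ ((e z).unop ≫ (e w).unop) ≫ r w := by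
      rw [← hri, ← hri]
      simp only [Category.assoc, hir]
      rw [← Category.assoc (i z), hir]
      simp
    rw [h2, h1]
    simp
  · change r z ≫ 𝟙 _ ≫ i z = _
    rw [Category.id_comp, hri]

variable [HasCoproducts.{v} C]

/-- The summands of an object isomorphic to a coproduct. -/
def SplitFamily.ofIso {M : C} {Z : Type v} {N : Z → C} (φ : M ≅ ∐ N) : SplitFamily M N where
  i z := Sigma.ι N z ≫ φ.inv
  r z := φ.hom ≫ coprodProj N z
  i_r_self z := by simp [ι_coprodProj_self]
  i_r_of_ne h := by simp [ι_coprodProj_of_ne N h]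

variable [RightTopological C] [TopologicallyAgreeable C]

theorem SplitFamily.hasSum_ofIso {M : C} {Z : Type v} {N : Z → C} (φ : M ≅ ∐ N) :
    HasSum (SplitFamily.ofIso φ).idem 1 := by
  have h1 := hasSum_postcomp (hasSum_precomp (hasSum_coprodProj_ι N) φ.hom) φ.inv
  have h2 := HasSum.op (α := End M) h1
  simp only [Category.comp_id, Iso.hom_inv_id] at h2
  have h3 : (SplitFamily.ofIso φ).idem = fun z =>
      MulOpposite.op ((φ.hom ≫ coprodProj N z ≫ Sigma.ι N z) ≫ φ.inv) := funext fun z => by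
    simp [SplitFamily.idem, SplitFamily.extend, SplitFamily.ofIso]
  rw [h3]
  exact h2

theorem hasPerfectDecomposition_iff_exists_isPerfectFamily [IsIdempotentComplete C] (M : C) :
    HasPerfectDecomposition M ↔ ∃ (Z : Type v) (e : Z → (End M)ᵐᵒᵖ), IsPerfectFamily e := by
  constructor
  · rintro ⟨Z, N, hN, ⟨φ⟩⟩
    exact ⟨Z, _, ((SplitFamily.ofIso φ).isPerfectFamily_iff (SplitFamily.hasSum_ofIso φ)).2 hN⟩
  · rintro ⟨Z, e, he⟩
    obtain ⟨N, S, rfl⟩ := exists_splitFamily he.orthogonal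
    exact ⟨Z, N, (S.isPerfectFamily_iff he.hasSum).1 he, S.nonempty_iso he.hasSum⟩

end Splittings

end TopPerfect

end

theorem mainTheorem5 {C : Type u} [Category.{v} C] [Preadditive C] [HasFiniteBiproducts C]
    [HasCoproducts.{v} C] [IsIdempotentComplete C] [TopPerfect.RightTopological C]
    [TopPerfect.TopologicallyAgreeable C] (M : C) :
    TopPerfect.HasPerfectDecomposition M ↔ TopPerfect.IsTopLeftPerfect (End M)ᵐᵒᵖ := by
  rw [TopPerfect.hasPerfectDecomposition_iff_exists_isPerfectFamily]
  exact ⟨fun ⟨_, _, h⟩ => h.isTopLeftPerfect (TopPerfect.isCompleteGroup_endOp M),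
    fun h => h.exists_isPerfectFamily (TopPerfect.isCompleteGroup_endOp M)⟩
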